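/- Let $\Omega\subseteq\mathbb R^2$ be open (possibly unbounded), let $\beta,\gamma>0$, and let $L^2(\Omega)$ be the real Hilbert space of square-integrable functions on $\Omega$. For $u\in L^2(\Omega)$ put $$\int_\Omega(|u_{x_1}|+|u_{x_2}|):=\sup\Big\{-\int_\Omega u\,\operatorname{div}z\,dx:\ z\in C^1_c(\Omega;\mathbb R^2),\ \max(|z_1|,|z_2|)\le 1\Big\},$$ and let $$\Phi_0(u)=\begin{cases}\beta\int_\Omega(|u_{x_1}|+|u_{x_2}|)&\text{if }u\text{ has finite total variation in }\Omega,\\+\infty&\text{otherwise,}\end{cases}$$ (if $\Omega$ has finite measure, $u\in L^2(\Omega)$ has finite total variation exactly when $u\in BV(\Omega)$), and $$\Phi_1(u)=\begin{cases}\int_\Omega\big(\tfrac{\gamma}{2}|\nabla u|^2+\beta(|u_{x_1}|+|u_{x_2}|)\big)\,dx\in[0,\infty]&\text{if }u\in H^1(\Omega),\\+\infty&\text{otherwise.}\end{cases}$$ For $i=0,1$ let $A_i=\partial\Phi_i$ be the subdifferential on $L^2(\Omega)$, that is, $\xi\in A_i(u)$ iff $\Phi_i(u)<\infty$ and $\Phi_i(u)+(\xi,w-u)_{L^2}\le\Phi_i(w)$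 for all $w\in L^2(\Omega)$; let $D(A_i)=\{u: A_i(u)\ne\emptyset\}$, and for $u\in D(A_i)$ let $A_i^o(u)$ be the element of minimal norm of $A_i(u)$. Then for $i=0,1$ and every $u_0\in L^2(\Omega)$ (not only $u_0\in D(A_i)$) the problem $$\frac{d^+u}{dt}+A_i(u(t))\ni 0,\qquad u(0)=u_0,$$ has a unique solution $u:[0,\infty)\to L^2(\Omega)$. More precisely, there is a continuous $u:[0,\infty)\to L^2(\Omega)$ with $u(0)=u_0$ that is absolutely continuous on compact subintervals of $(0,\infty)$, has a right derivative at every $t>0$, and satisfies the inclusion at every $t>0$. It is unique both among the continuous functions on $[0,\infty)$ with initial value $u_0$ which have a right derivative and satisfy the inclusion at every $t>0$, and among the continuous functions on $[0,\infty)$ with initial value $u_0$ which are absolutely continuous on compact subintervals of $(0,\infty)$ and, at almost every $t>0$, have a right derivative and satisfy the inclusion. Moreover, for all $t>0$ one has $u(t)\in D(A_i)$ and $$\frac{d^+u}{dt}(t)+A_i^o(u(t))=0.$$ -/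

import Mathlib

open MeasureTheory Set
open scoped ContDiff

noncomputable section

namespace AnisoDiffusion

/-- The Euclidean plane. -/
abbrev Plane : Type := EuclideanSpace ℝ (Fin 2)

/-- The real Hilbert space `L²(Ω)`, with respect to Lebesgue measure on `Ω`. -/
abbrev L2 (Ω : Set Plane) : Type := Lp ℝ 2 (volume.restrict Ω)

/-- The `i`-th partial derivative of a scalar function on the plane. -/
def partialDeriv (i : Fin 2) (φ : Plane → ℝ) (x : Plane) : ℝ :=
  fderiv ℝ φ x (EuclideanSpace.single i 1)

/-- The divergence of a vector field on the plane. -/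
def divergence (z : Plane → Plane) (x : Plane) : ℝ :=
  ∑ i : Fin 2, partialDeriv i (fun y => z y i) x

/-- `C¹` vector fields with compact support contained in `Ω`. -/
structure IsTestField (Ω : Set Plane) (z : Plane → Plane) : Prop where
  contDiff : ContDiff ℝ 1 z
  compact : HasCompactSupport z
  support : tsupport z ⊆ Ω

/-- The pairing `∫_Ω (z, Du)` of a test field `z` with the distributional gradient of `u`,
that is, `-∫_Ω u div z`. -/
def gradPairing (Ω : Set Plane) (u : L2 Ω) (z : Plane → Plane) : ℝ :=
  -∫ x in Ω, u x * divergence z x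

/-- `u ∈ L²(Ω)` is of bounded variation in `Ω`: its distributional gradient is a finite
vector measure, equivalently its (Euclidean) total variation is finite. If `Ω` has finite
measure then `L²(Ω) ⊆ L¹(Ω)`, and this says that `u` lies in the usual space `BV(Ω)`. -/
def IsBV (Ω : Set Plane) (u : L2 Ω) : Prop :=
  ∃ C : ℝ, ∀ z : Plane → Plane, IsTestField Ω z → (∀ x, ‖z x‖ ≤ 1) → gradPairing Ω u z ≤ C

/-- `∫_Ω (|u_{x₁}| + |u_{x₂}|)`, the supremum of `∫_Ω (z, Du)` over test fields `z` with
`max (|z₁|, |z₂|) ≤ 1`. -/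
def anisoVariation (Ω : Set Plane) (u : L2 Ω) : EReal :=
  ⨆ (z : Plane → Plane) (_ : IsTestField Ω z) (_ : ∀ x i, |z x i| ≤ 1),
    ((gradPairing Ω u z : ℝ) : EReal)

open Classical in
/-- The anisotropic total variation functional `Φ₀` on `L²(Ω)`. -/
def Phi0 (Ω : Set Plane) (β : ℝ) (u : L2 Ω) : EReal :=
  if IsBV Ω u then (β : EReal) * anisoVariation Ω u else ⊤

/-- `g ∈ L²(Ω; ℝ²)` is the weak gradient of `u` in `Ω`. -/
def HasWeakGradient (Ω : Set Plane) (u : L2 Ω) (g : Lp Plane 2 (volume.restrict Ω)) : Prop :=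
  ∀ φ : Plane → ℝ, ContDiff ℝ ∞ φ → HasCompactSupport φ → tsupport φ ⊆ Ω →
    ∀ i : Fin 2, ∫ x in Ω, u x * partialDeriv i φ x = -∫ x in Ω, g x i * φ x

/-- `u ∈ H¹(Ω)`: `u ∈ L²(Ω)` has a weak gradient in `L²(Ω; ℝ²)`. -/
def IsH1 (Ω : Set Plane) (u : L2 Ω) : Prop :=
  ∃ g, HasWeakGradient Ω u g

/-- The weak gradient of `u ∈ H¹(Ω)`; it is unique if `Ω` is open, see
`HasWeakGradient.unique`. -/
def weakGradient {Ω : Set Plane} {u : L2 Ω} (h : IsH1 Ω u) : Lp Plane 2 (volume.restrict Ω) :=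
  h.choose

theorem HasWeakGradient.unique {Ω : Set Plane} (hΩ : IsOpen Ω) {u : L2 Ω}
    {g g' : Lp Plane 2 (volume.restrict Ω)} (h : HasWeakGradient Ω u g)
    (h' : HasWeakGradient Ω u g') : g = g' := by
  have key : ∀ i : Fin 2, ∀ᵐ x ∂(volume : Measure Plane), x ∈ Ω → g x i - g' x i = 0 := by
    intro i
    have hloc : ∀ f : Lp Plane 2 (volume.restrict Ω),
        LocallyIntegrable (fun x => f x i) (volume.restrict Ω) := by
      intro f
      have hf : MemLp (fun x => f x i) 2 (volume.restrict Ω) := by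
        have h1 : MemLp (fun x => f x) 2 (volume.restrict Ω) := Lp.memLp f
        have h2 : AEStronglyMeasurable (fun x => f x i) (volume.restrict Ω) :=
          (by fun_prop : Continuous fun y : Plane => y i).comp_aestronglyMeasurable
            h1.aestronglyMeasurable
        exact h1.mono h2 (Filter.Eventually.of_forall fun x => PiLp.norm_apply_le (f x) i)
      exact hf.locallyIntegrable (by norm_num)
    refine hΩ.ae_eq_zero_of_integral_contDiff_smul_eq_zero ?_ ?_
    · have := locallyIntegrableOn_of_locallyIntegrable_restrict ((hloc g).sub (hloc g'))
      exact this
    · intro φ hφ hc hs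
      have e : (∫ x in Ω, g x i * φ x) = ∫ x in Ω, g' x i * φ x := by
        have h1 := h φ hφ hc hs i
        have h2 := h' φ hφ hc hs i
        linarith
      have int : ∀ f : Lp Plane 2 (volume.restrict Ω),
          Integrable (fun x => f x i * φ x) (volume.restrict Ω) := by
        intro f
        have := (hloc f).integrable_smul_right_of_hasCompactSupport hφ.continuous hc
        simpa [smul_eq_mul] using this
      have hz : ∀ x, x ∉ Ω → φ x • (g x i - g' x i) = 0 := by
        intro x hx
        have : φ x = 0 := image_eq_zero_of_notMem_tsupport (fun h => hx (hs h))
        simp [this]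
      rw [← setIntegral_eq_integral_of_forall_compl_eq_zero hz]
      have : (fun x => φ x • (g x i - g' x i)) = fun x => g x i * φ x - g' x i * φ x := by
        funext x; simp only [smul_eq_mul]; ring
      rw [this, integral_sub (int g) (int g'), e, sub_self]
  apply Lp.ext
  rw [Filter.EventuallyEq, ae_restrict_iff' hΩ.measurableSet]
  filter_upwards [key 0, key 1] with x h0 h1 hx
  ext i
  fin_cases i
  · exact sub_eq_zero.1 (h0 hx)
  · exact sub_eq_zero.1 (h1 hx)

open Classical in
/-- The functional `Φ₁` on `L²(Ω)`, with value
`∫_Ω ((γ/2) |∇u|² + β (|u_{x₁}| + |u_{x₂}|)) ∈ [0, ∞]` on `H¹(Ω)` and `∞` elsewhere. -/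
def Phi1 (Ω : Set Plane) (β γ : ℝ) (u : L2 Ω) : EReal :=
  if h : IsH1 Ω u then
    ((∫⁻ x in Ω, ENNReal.ofReal (γ / 2 * ‖weakGradient h x‖ ^ 2
      + β * (|weakGradient h x 0| + |weakGradient h x 1|)) : ENNReal) : EReal)
  else ⊤

section Hilbert

variable {H : Type*} [NormedAddCommGroup H] [InnerProductSpace ℝ H]

/-- The subdifferential of a functional `φ : H → (-∞, ∞]`, as a multivalued operator. -/
def subdifferential (φ : H → EReal) (x : H) : Set H :=
  {ξ | φ x ≠ ⊤ ∧ ∀ y, φ x + ((inner ℝ ξ (y - x) : ℝ) : EReal) ≤ φ y}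

/-- The domain of a multivalued operator. -/
def domain (A : H → Set H) : Set H := {x | (A x).Nonempty}

/-- The elements of minimal norm of `A x`. For a subdifferential, `A x` is closed and convex,
so for `x` in the domain there is exactly one, the value `A° x` of the minimal section. -/
def minimalSection (A : H → Set H) (x : H) : Set H :=
  {ξ | ξ ∈ A x ∧ ∀ η ∈ A x, ‖ξ‖ ≤ ‖η‖}

/-- `d⁺u/dt (t) + B (u t) ∋ 0`: the right derivative of `u` at `t` exists and its negative
belongs to `B (u t)`. -/
def RightInclusion (B : H → Set H) (u : ℝ → H) (t : ℝ) : Prop :=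
  ∃ ξ ∈ B (u t), HasDerivWithinAt u (-ξ) (Ici t) t

/-- `u : [0, ∞) → H` is continuous, `u 0 = u₀`, and the inclusion holds at every `t > 0`.
Values at negative times play no role. -/
structure IsPointwiseSolution (A : H → Set H) (u₀ : H) (u : ℝ → H) : Prop where
  continuousOn : ContinuousOn u (Ici 0)
  initial : u 0 = u₀
  inclusion : ∀ t, 0 < t → RightInclusion A u t

/-- Strong solutions: `u : [0, ∞) → H` is continuous, absolutely continuous on compact
subintervals of `(0, ∞)`, `u 0 = u₀`, and the inclusion holds at almost every `t > 0`. -/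
structure IsStrongSolution (A : H → Set H) (u₀ : H) (u : ℝ → H) : Prop where
  continuousOn : ContinuousOn u (Ici 0)
  absolutelyContinuous : ∀ a b, 0 < a → a ≤ b → AbsolutelyContinuousOnInterval u a b
  initial : u 0 = u₀
  inclusion : ∀ᵐ t ∂(volume : Measure ℝ), 0 < t → RightInclusion A u t

end Hilbert

/-- The operators `A₀ = ∂Φ₀` and `A₁ = ∂Φ₁` on `L²(Ω)`. -/
def A (Ω : Set Plane) (β γ : ℝ) (i : Fin 2) : L2 Ω → Set (L2 Ω) :=
  subdifferential (if i = 0 then Phi0 Ω β else Phi1 Ω β γ)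

end AnisoDiffusion

end

noncomputable section

namespace AnisoDiffusion

open Filter Topology

/-! ### Resolvents and Yosida approximations of a monotone operator. -/

section Semigroup

variable {H : Type*} [NormedAddCommGroup H] [InnerProductSpace ℝ H]

/-! Both functionals are convex, lower semicontinuous and finite on a dense set, so the theorem is
an instance of the theory of gradient flows in Hilbert space, carried out here from scratch.

Generation: solving a proximal problem for every step size makes the resolvents of the
subdifferential everywhere defined, and monotonicity makes them contractions. Kobayashi's estimate
`norm_iterate_sub_iterate_sq_le` compares Euler schemes with different steps, so they converge to a
contraction semigroup.

Smoothing: because the operator is a subdifferential, `iterate_smoothing` bounds the discrete speed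
at time t by a multiple of 1/t for arbitrary initial data. In the limit the Yosida approximations at
the point reached are bounded uniformly in the parameter, which forces that point into the domain.
There `hasDerivWithinAt_semigroup` identifies the right derivative with minus the element of minimal
norm. Uniqueness holds because monotonicity makes the distance of two solutions nonincreasing.

Proximal problems: minimizing sequences are Cauchy by uniform convexity, so closed sublevel sets
suffice and no weak compactness is used. For `Phi0` the sublevel sets are closed because it is a
supremum of continuous linear functionals; for `Phi1` one minimizes over pairs of a function and its
weak gradient, using closedness of the gradient and Fatou's lemma. -/

/-- A densely defined maximal monotone operator `A` which is the subdifferential of a nonnegative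
energy `e` vanishing at its minimum point `0`. -/
structure IsGradientOperator (A : H → Set H) (e : H → ℝ) : Prop where
  monotone : ∀ {x y ξ η : H}, ξ ∈ A x → η ∈ A y → 0 ≤ inner ℝ (ξ - η) (x - y)
  surjective : ∀ l : ℝ, 0 < l → ∀ f : H, ∃ u, l⁻¹ • (f - u) ∈ A u
  dense : Dense (domain A)
  energy_nonneg : ∀ x, 0 ≤ e x
  energy_zero : e 0 = 0
  energy_le : ∀ {x y ξ : H}, ξ ∈ A x → (y = 0 ∨ y ∈ domain A) → e x + inner ℝ ξ (y - x) ≤ e y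

open Classical in
/-- The resolvent `(1 + l A)⁻¹`. -/
def resolvent (A : H → Set H) (l : ℝ) (f : H) : H :=
  if h : ∃ u, l⁻¹ • (f - u) ∈ A u then h.choose else f

/-- The Yosida approximation `(1 - (1 + l A)⁻¹) / l`. -/
def yosida (A : H → Set H) (l : ℝ) (f : H) : H := l⁻¹ • (f - resolvent A l f)

/-- The implicit Euler scheme with step `l` at time `t`. -/
def eulerStep (A : H → Set H) (l t : ℝ) (x : H) : H := (resolvent A l)^[⌊t / l⌋₊] x

namespace IsGradientOperator

variable {A : H → Set H} {e : H → ℝ} (hA : IsGradientOperator A e)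

include hA

theorem yosida_mem {l : ℝ} (hl : 0 < l) (f : H) : yosida A l f ∈ A (resolvent A l f) := by
  have h := hA.surjective l hl f
  have : resolvent A l f = h.choose := by simp [resolvent, h]
  rw [yosida, this]
  exact h.choose_spec

omit hA in
theorem _root_.AnisoDiffusion.resolvent_eq {l : ℝ} (hl : 0 < l) (f : H) :
    resolvent A l f = f - l • yosida A l f := by
  rw [yosida, smul_inv_smul₀ hl.ne']; abel

theorem resolvent_mem_domain {l : ℝ} (hl : 0 < l) (f : H) : resolvent A l f ∈ domain A :=
  ⟨_, hA.yosida_mem hl f⟩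

theorem norm_resolvent_sub_le {l : ℝ} (hl : 0 < l) (x y : H) :
    ‖resolvent A l x - resolvent A l y‖ ≤ ‖x - y‖ := by
  have h := hA.monotone (hA.yosida_mem hl x) (hA.yosida_mem hl y)
  set u := resolvent A l x with hu
  set v := resolvent A l y with hv
  have e1 : yosida A l x - yosida A l y = l⁻¹ • ((x - y) - (u - v)) := by
    rw [yosida, yosida, ← smul_sub]; congr 1; rw [← hu, ← hv]; abel
  rw [e1, inner_smul_left, inner_sub_left, real_inner_self_eq_norm_sq] at h
  have h2 : 0 ≤ inner ℝ (x - y) (u - v) - ‖u - v‖ ^ 2 :=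
    nonneg_of_mul_nonneg_right h (by simpa using hl)
  have h3 := real_inner_le_norm (x - y) (u - v)
  by_contra hlt
  push Not at hlt
  nlinarith [norm_nonneg (x - y), norm_nonneg (u - v)]

theorem continuous_resolvent {l : ℝ} (hl : 0 < l) : Continuous (resolvent A l) :=
  (LipschitzWith.of_dist_le_mul (K := 1) fun x y => by
    simpa [dist_eq_norm] using hA.norm_resolvent_sub_le hl x y).continuous

theorem continuous_yosida {l : ℝ} (hl : 0 < l) : Continuous (yosida A l) :=
  (continuous_id.sub (hA.continuous_resolvent hl)).const_smul l⁻¹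

theorem norm_iterate_sub_le {l : ℝ} (hl : 0 < l) (n : ℕ) (x y : H) :
    ‖(resolvent A l)^[n] x - (resolvent A l)^[n] y‖ ≤ ‖x - y‖ := by
  induction n with
  | zero => simp
  | succ n ih =>
    rw [Function.iterate_succ_apply', Function.iterate_succ_apply']
    exact (hA.norm_resolvent_sub_le hl _ _).trans ih

theorem norm_yosida_le {l : ℝ} (hl : 0 < l) {x η : H} (hη : η ∈ A x) : ‖yosida A l x‖ ≤ ‖η‖ := by
  have h := hA.monotone hη (hA.yosida_mem hl x)
  rw [resolvent_eq hl, sub_sub_cancel, inner_smul_right, inner_sub_left,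
    real_inner_self_eq_norm_sq] at h
  have h2 := nonneg_of_mul_nonneg_right h hl
  have h3 := real_inner_le_norm η (yosida A l x)
  by_contra hlt
  push Not at hlt
  nlinarith [norm_nonneg η, norm_nonneg (yosida A l x)]

/-- Monotonicity between the two resolvents gives (m - l)(⟨a, b⟩ - ‖b‖²) ≥ l‖a - b‖² for the two
Yosida values a and b, hence ⟨a, b⟩ ≥ ‖b‖². So the norms grow as the parameter decreases, and
bounded norms force convergence. -/
theorem norm_yosida_sub_sq_le {l m : ℝ} (hl : 0 < l) (hlm : l < m) (x : H) :
    ‖yosida A l x - yosida A m x‖ ^ 2 ≤ ‖yosida A l x‖ ^ 2 - ‖yosida A m x‖ ^ 2 := by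
  have hm := hl.trans hlm
  have h := hA.monotone (hA.yosida_mem hl x) (hA.yosida_mem hm x)
  rw [resolvent_eq hl, resolvent_eq hm, sub_sub_sub_cancel_left] at h
  set a := yosida A l x
  set b := yosida A m x
  rw [norm_sub_sq_real]
  simp only [inner_sub_left, inner_sub_right, inner_smul_right, real_inner_self_eq_norm_sq,
    real_inner_comm a b] at h
  have h4 : ‖a - b‖ ^ 2 = ‖a‖ ^ 2 - 2 * inner ℝ a b + ‖b‖ ^ 2 := norm_sub_sq_real a b
  have h5 := sq_nonneg ‖a - b‖
  have h6 : 0 ≤ (m - l) * (inner ℝ a b - ‖b‖ ^ 2) := by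
    have := real_inner_comm a b
    nlinarith
  have h7 := nonneg_of_mul_nonneg_right h6 (sub_pos.2 hlm)
  linarith

/-- Maximality of a monotone operator with full range condition. -/
theorem mem_of_forall_inner_nonneg {x ξ : H}
    (h : ∀ y, ∀ η ∈ A y, 0 ≤ inner ℝ (ξ - η) (x - y)) : ξ ∈ A x := by
  -- With y the resolvent of x + ξ, testing against the element x + ξ - y of `A y` turns the
  -- hypothesis into -‖x - y‖² ≥ 0.
  have h1 := hA.yosida_mem one_pos (x + ξ)
  have h2 := h _ _ h1
  have e1 : yosida A 1 (x + ξ) = x + ξ - resolvent A 1 (x + ξ) := by simp [yosida]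
  set y := resolvent A 1 (x + ξ)
  have e2 : ξ - (x + ξ - y) = -(x - y) := by abel
  rw [e1, e2, inner_neg_left, real_inner_self_eq_norm_sq] at h2
  have h3 : x - y = 0 := by
    have := sq_nonneg ‖x - y‖
    exact norm_eq_zero.1 (pow_eq_zero_iff two_ne_zero |>.1 (by linarith))
  have h4 : y = x := (sub_eq_zero.1 h3).symm
  rw [e1, h4] at h1
  simpa using h1

/-- If the Yosida approximations are bounded at `x`, then they converge to an element of minimal
norm of `A x`. -/
theorem exists_mem_minimalSection [CompleteSpace H] {x : H} {C : ℝ}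
    (hC : ∀ l, 0 < l → ‖yosida A l x‖ ≤ C) :
    ∃ ξ ∈ minimalSection A x, Tendsto (fun n : ℕ => yosida A (1 / ((n : ℝ) + 1)) x) atTop (𝓝 ξ) ∧
      ∀ l, 0 < l → ‖yosida A l x - ξ‖ ^ 2 ≤ ‖ξ‖ ^ 2 - ‖yosida A l x‖ ^ 2 := by
  set a : ℕ → H := fun n => yosida A (1 / ((n : ℝ) + 1)) x with ha
  have hpos : ∀ n : ℕ, (0 : ℝ) < 1 / ((n : ℝ) + 1) := fun n => Nat.one_div_pos_of_nat
  have key : ∀ n m, n ≤ m → ‖a m - a n‖ ^ 2 ≤ ‖a m‖ ^ 2 - ‖a n‖ ^ 2 := by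
    intro n m hnm
    rcases hnm.eq_or_lt with rfl | h
    · simp
    · exact hA.norm_yosida_sub_sq_le (hpos m) (Nat.one_div_lt_one_div h) x
  have hmono : Monotone fun n => ‖a n‖ ^ 2 := fun n m hnm => by
    have := key n m hnm
    have := sq_nonneg ‖a m - a n‖
    show ‖a n‖ ^ 2 ≤ ‖a m‖ ^ 2
    linarith
  have hbdd : BddAbove (range fun n => ‖a n‖ ^ 2) := by
    refine ⟨C ^ 2, ?_⟩
    rintro _ ⟨n, rfl⟩
    exact pow_le_pow_left₀ (norm_nonneg _) (hC _ (hpos n)) 2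
  have hconv := tendsto_atTop_ciSup hmono hbdd
  have hcs : CauchySeq a := by
    rw [Metric.cauchySeq_iff']
    intro ε hε
    obtain ⟨N, hN⟩ := Metric.cauchySeq_iff'.1 hconv.cauchySeq (ε ^ 2) (by positivity)
    refine ⟨N, fun n hn => ?_⟩
    have h1 := hN n hn
    rw [Real.dist_eq] at h1
    rw [dist_eq_norm]
    have h2 := (key N n hn).trans_lt ((le_abs_self _).trans_lt h1)
    exact lt_of_pow_lt_pow_left₀ 2 hε.le h2
  obtain ⟨ξ, hξ⟩ := cauchySeq_tendsto_of_complete hcs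
  have hres : Tendsto (fun n : ℕ => resolvent A (1 / ((n : ℝ) + 1)) x) atTop (𝓝 x) := by
    have h1 : Tendsto (fun n : ℕ => x - (1 / ((n : ℝ) + 1)) • a n) atTop
        (𝓝 (x - (0 : ℝ) • ξ)) :=
      tendsto_const_nhds.sub (tendsto_one_div_add_atTop_nhds_zero_nat.smul hξ)
    rw [zero_smul, sub_zero] at h1
    exact h1.congr fun n => (resolvent_eq (hpos n) x).symm
  -- The graph is closed: monotonicity against any fixed pair passes to the limit, and maximality
  -- concludes.
  have hmem : ξ ∈ A x := by
    refine hA.mem_of_forall_inner_nonneg fun y η hη => ?_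
    refine ge_of_tendsto' ((hξ.sub_const η).inner (hres.sub_const y)) fun n => ?_
    exact hA.monotone (hA.yosida_mem (hpos n) x) hη
  refine ⟨ξ, ⟨hmem, fun η hη => ?_⟩, hξ, fun l hl => ?_⟩
  · exact le_of_tendsto' hξ.norm fun n => hA.norm_yosida_le (hpos n) hη
  · have h1 : Tendsto (fun n => ‖yosida A l x - a n‖ ^ 2) atTop (𝓝 (‖yosida A l x - ξ‖ ^ 2)) :=
      ((tendsto_const_nhds.sub hξ).norm.pow 2)
    have h2 : Tendsto (fun n => ‖a n‖ ^ 2 - ‖yosida A l x‖ ^ 2) atTop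
        (𝓝 (‖ξ‖ ^ 2 - ‖yosida A l x‖ ^ 2)) := ((hξ.norm.pow 2).sub_const _)
    refine le_of_tendsto_of_tendsto h1 h2 ?_
    have h3 := (tendsto_one_div_add_atTop_nhds_zero_nat (𝕜 := ℝ)).eventually (gt_mem_nhds hl)
    filter_upwards [h3] with n hn
    rw [norm_sub_rev]
    exact hA.norm_yosida_sub_sq_le (hpos n) hn x

/-! ### Convergence of the implicit Euler scheme. -/

theorem norm_iterate_sub_self_le {l : ℝ} (hl : 0 < l) {x ξ : H} (hξ : ξ ∈ A x) (n : ℕ) :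
    ‖(resolvent A l)^[n] x - x‖ ≤ n * l * ‖ξ‖ := by
  have h1 : ‖resolvent A l x - x‖ ≤ l * ‖ξ‖ := by
    rw [resolvent_eq hl, sub_sub_cancel_left, norm_neg, norm_smul, Real.norm_of_nonneg hl.le]
    exact mul_le_mul_of_nonneg_left (hA.norm_yosida_le hl hξ) hl.le
  induction n with
  | zero => simp
  | succ n ih =>
    rw [Function.iterate_succ_apply]
    have h2 := hA.norm_iterate_sub_le hl n (resolvent A l x) x
    have h3 := norm_sub_le_norm_sub_add_norm_sub ((resolvent A l)^[n] (resolvent A l x))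
      ((resolvent A l)^[n] x) x
    push_cast
    linarith

/-- Kobayashi's estimate for two implicit Euler schemes. -/
theorem norm_iterate_sub_iterate_sq_le {l m : ℝ} (hl : 0 < l) (hm : 0 < m) {x ξ : H}
    (hξ : ξ ∈ A x) (j k : ℕ) :
    ‖(resolvent A l)^[j] x - (resolvent A m)^[k] x‖ ^ 2 ≤
      ‖ξ‖ ^ 2 * ((j * l - k * m) ^ 2 + j * l ^ 2 + k * m ^ 2) := by
  induction j generalizing k with
  | zero =>
    have h1 := hA.norm_iterate_sub_self_le hm hξ k
    have h2 := pow_le_pow_left₀ (norm_nonneg _) h1 2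
    rw [Function.iterate_zero, id, norm_sub_rev]
    have h3 : 0 ≤ ‖ξ‖ ^ 2 * (k * m ^ 2) := by positivity
    push_cast
    nlinarith
  | succ j ihj =>
    induction k with
    | zero =>
      have h1 := hA.norm_iterate_sub_self_le hl hξ (j + 1)
      have h2 := pow_le_pow_left₀ (norm_nonneg _) h1 2
      have h3 : 0 ≤ ‖ξ‖ ^ 2 * ((j + 1) * l ^ 2) := by positivity
      rw [Function.iterate_zero, id]
      push_cast at h2 ⊢
      nlinarith
    | succ k ihk =>
      have h1 := ihj (k + 1)
      rw [Function.iterate_succ_apply'] at ihk h1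
      rw [Function.iterate_succ_apply', Function.iterate_succ_apply']
      set p := (resolvent A l)^[j] x
      set q := (resolvent A m)^[k] x
      have h2 := hA.monotone (hA.yosida_mem hl p) (hA.yosida_mem hm q)
      rw [yosida, yosida] at h2
      set u := resolvent A l p
      set v := resolvent A m q
      -- This regrouping brings in only p - v and u - q, the differences at the neighbouring index
      -- pairs (j, k + 1) and (j + 1, k) covered by the induction hypotheses.
      have e1 : l⁻¹ • (p - u) - m⁻¹ • (q - v) =
          l⁻¹ • ((p - v) - (u - v)) + m⁻¹ • ((u - q) - (u - v)) := by
        simp only [smul_sub]; abel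
      rw [e1, inner_add_left, inner_smul_left, inner_smul_left, inner_sub_left (p - v),
        inner_sub_left (u - q), real_inner_self_eq_norm_sq] at h2
      simp only [conj_trivial] at h2
      have h3 := real_inner_le_norm (p - v) (u - v)
      have h4 := real_inner_le_norm (u - q) (u - v)
      have h5 : inner ℝ (p - v) (u - v) - ‖u - v‖ ^ 2 ≤ (‖p - v‖ ^ 2 - ‖u - v‖ ^ 2) / 2 := by
        nlinarith [sq_nonneg (‖p - v‖ - ‖u - v‖)]
      have h6 : inner ℝ (u - q) (u - v) - ‖u - v‖ ^ 2 ≤ (‖u - q‖ ^ 2 - ‖u - v‖ ^ 2) / 2 := by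
        nlinarith [sq_nonneg (‖u - q‖ - ‖u - v‖)]
      have h7 : 0 ≤ l⁻¹ * ((‖p - v‖ ^ 2 - ‖u - v‖ ^ 2) / 2) +
          m⁻¹ * ((‖u - q‖ ^ 2 - ‖u - v‖ ^ 2) / 2) :=
        h2.trans (add_le_add (mul_le_mul_of_nonneg_left h5 (by positivity))
          (mul_le_mul_of_nonneg_left h6 (by positivity)))
      have h8 : (l + m) * ‖u - v‖ ^ 2 ≤ m * ‖p - v‖ ^ 2 + l * ‖u - q‖ ^ 2 := by
        have h9 : 0 ≤ 2 * (l * m) * (l⁻¹ * ((‖p - v‖ ^ 2 - ‖u - v‖ ^ 2) / 2) +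
          m⁻¹ * ((‖u - q‖ ^ 2 - ‖u - v‖ ^ 2) / 2)) := by positivity
        have e2 : 2 * (l * m) * (l⁻¹ * ((‖p - v‖ ^ 2 - ‖u - v‖ ^ 2) / 2) +
          m⁻¹ * ((‖u - q‖ ^ 2 - ‖u - v‖ ^ 2) / 2)) =
            m * (‖p - v‖ ^ 2 - ‖u - v‖ ^ 2) + l * (‖u - q‖ ^ 2 - ‖u - v‖ ^ 2) := by
          field_simp
        rw [e2] at h9
        linarith
      have h10 := mul_le_mul_of_nonneg_left h1 hm.le
      have h11 := mul_le_mul_of_nonneg_left ihk hl.le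
      refine le_of_mul_le_mul_left ?_ (add_pos hl hm)
      -- The claimed bound satisfies the recursion `h8` with equality.
      refine h8.trans ((add_le_add h10 h11).trans (le_of_eq ?_))
      push_cast
      ring

theorem norm_eulerStep_sub_eulerStep_sq_le {l m : ℝ} (hl : 0 < l) (hm : 0 < m) {x ξ : H}
    (hξ : ξ ∈ A x) {t s : ℝ} (ht : 0 ≤ t) (hs : 0 ≤ s) :
    ‖eulerStep A l t x - eulerStep A m s x‖ ^ 2 ≤
      ‖ξ‖ ^ 2 * ((|t - s| + l + m) ^ 2 + t * l + s * m) := by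
  refine (hA.norm_iterate_sub_iterate_sq_le hl hm hξ _ _).trans
    (mul_le_mul_of_nonneg_left ?_ (sq_nonneg _))
  have key : ∀ {t l : ℝ}, 0 ≤ t → 0 < l → ⌊t / l⌋₊ * l ≤ t ∧ t < ⌊t / l⌋₊ * l + l := by
    intro t l ht hl
    have h1 := Nat.floor_le (div_nonneg ht hl.le)
    have h2 := Nat.lt_floor_add_one (t / l)
    rw [le_div_iff₀ hl] at h1
    rw [div_lt_iff₀ hl] at h2
    exact ⟨h1, by linarith⟩
  obtain ⟨h1, h2⟩ := key ht hl
  obtain ⟨h3, h4⟩ := key hs hm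
  have h5 : |⌊t / l⌋₊ * l - ⌊s / m⌋₊ * m| ≤ |t - s| + l + m := by
    rw [abs_le]
    have := neg_abs_le (t - s)
    have := le_abs_self (t - s)
    constructor <;> linarith
  have h6 := sq_le_sq' (abs_le.1 h5).1 (abs_le.1 h5).2
  nlinarith

theorem norm_eulerStep_sub_le {l : ℝ} (hl : 0 < l) (t : ℝ) (x y : H) :
    ‖eulerStep A l t x - eulerStep A l t y‖ ≤ ‖x - y‖ :=
  hA.norm_iterate_sub_le hl _ x y

/-- On the domain this is Kobayashi's estimate at equal times; contractivity and density extend it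
to every x. -/
theorem cauchySeq_eulerStep {t : ℝ} (ht : 0 ≤ t) (x : H) :
    CauchySeq fun n : ℕ => eulerStep A (1 / ((n : ℝ) + 1)) t x := by
  have hpos : ∀ n : ℕ, (0 : ℝ) < 1 / ((n : ℝ) + 1) := fun n => Nat.one_div_pos_of_nat
  rw [Metric.cauchySeq_iff']
  intro ε hε
  obtain ⟨y, hy, η, hη⟩ := Metric.dense_iff.1 hA.dense x (ε / 3) (by positivity)
  rw [Metric.mem_ball, dist_comm, dist_eq_norm] at hy
  have h1 : Tendsto (fun n : ℕ => ‖η‖ ^ 2 * ((1 / ((n : ℝ) + 1) + 1 / ((n : ℝ) + 1)) ^ 2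
      + t * (1 / ((n : ℝ) + 1)) + t * (1 / ((n : ℝ) + 1)))) atTop
      (𝓝 (‖η‖ ^ 2 * ((0 + 0) ^ 2 + t * 0 + t * 0))) := by
    have h := tendsto_one_div_add_atTop_nhds_zero_nat (𝕜 := ℝ)
    exact ((((h.add h).pow 2).add (h.const_mul t)).add (h.const_mul t)).const_mul _
  rw [show ‖η‖ ^ 2 * (((0 : ℝ) + 0) ^ 2 + t * 0 + t * 0) = 0 by ring] at h1
  obtain ⟨N, hN⟩ := (h1.eventually (gt_mem_nhds (show 0 < (ε / 3) ^ 2 by positivity))).exists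
  refine ⟨N, fun n hn => ?_⟩
  have h2 := hA.norm_eulerStep_sub_eulerStep_sq_le (hpos n) (hpos N) hη ht ht
  rw [sub_self, abs_zero, zero_add] at h2
  have h3 : 1 / ((n : ℝ) + 1) ≤ 1 / ((N : ℝ) + 1) := Nat.one_div_le_one_div hn
  have h4 : ‖eulerStep A (1 / ((n : ℝ) + 1)) t y - eulerStep A (1 / ((N : ℝ) + 1)) t y‖ ^ 2
      < (ε / 3) ^ 2 := by
    refine (h2.trans ?_).trans_lt hN
    have := hpos n
    gcongr
  have h5 := lt_of_pow_lt_pow_left₀ 2 (by positivity) h4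
  have h6 := hA.norm_eulerStep_sub_le (hpos n) t x y
  have h7 := hA.norm_eulerStep_sub_le (hpos N) t y x
  rw [norm_sub_rev y x] at h7
  rw [dist_eq_norm]
  have h8 := norm_sub_le_norm_sub_add_norm_sub (eulerStep A (1 / ((n : ℝ) + 1)) t x)
    (eulerStep A (1 / ((n : ℝ) + 1)) t y) (eulerStep A (1 / ((N : ℝ) + 1)) t x)
  have h9 := norm_sub_le_norm_sub_add_norm_sub (eulerStep A (1 / ((n : ℝ) + 1)) t y)
    (eulerStep A (1 / ((N : ℝ) + 1)) t y) (eulerStep A (1 / ((N : ℝ) + 1)) t x)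
  linarith

/-! ### The semigroup as the limit of the Euler schemes. -/

omit hA in
/-- The semigroup generated by `-A`, given by the exponential formula. -/
def _root_.AnisoDiffusion.semigroup (A : H → Set H) (t : ℝ) (x : H) : H :=
  @limUnder _ _ _ ⟨x⟩ atTop fun n : ℕ => eulerStep A (1 / ((n : ℝ) + 1)) t x

variable [CompleteSpace H]

theorem tendsto_eulerStep {t : ℝ} (ht : 0 ≤ t) (x : H) :
    Tendsto (fun n : ℕ => eulerStep A (1 / ((n : ℝ) + 1)) t x) atTop (𝓝 (semigroup A t x)) :=
  CauchySeq.tendsto_limUnder (hA.cauchySeq_eulerStep ht x)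

theorem norm_semigroup_sub_le {t : ℝ} (ht : 0 ≤ t) (x y : H) :
    ‖semigroup A t x - semigroup A t y‖ ≤ ‖x - y‖ :=
  le_of_tendsto' ((hA.tendsto_eulerStep ht x).sub (hA.tendsto_eulerStep ht y)).norm fun _ =>
    hA.norm_eulerStep_sub_le Nat.one_div_pos_of_nat t x y

theorem continuous_semigroup {t : ℝ} (ht : 0 ≤ t) : Continuous (semigroup A t) :=
  (LipschitzWith.of_dist_le_mul (K := 1) fun x y => by
    simpa [dist_eq_norm] using hA.norm_semigroup_sub_le ht x y).continuous

theorem semigroup_zero (x : H) : semigroup A 0 x = x :=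
  tendsto_nhds_unique (hA.tendsto_eulerStep le_rfl x) (by simp [eulerStep])

theorem norm_semigroup_sub_semigroup_le {x ξ : H} (hξ : ξ ∈ A x) {t s : ℝ} (ht : 0 ≤ t)
    (hs : 0 ≤ s) : ‖semigroup A t x - semigroup A s x‖ ≤ ‖ξ‖ * |t - s| := by
  have h := tendsto_one_div_add_atTop_nhds_zero_nat (𝕜 := ℝ)
  have h1 : Tendsto (fun n : ℕ => ‖ξ‖ ^ 2 * ((|t - s| + 1 / ((n : ℝ) + 1)
      + 1 / ((n : ℝ) + 1)) ^ 2 + t * (1 / ((n : ℝ) + 1)) + s * (1 / ((n : ℝ) + 1)))) atTop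
      (𝓝 (‖ξ‖ ^ 2 * ((|t - s| + 0 + 0) ^ 2 + t * 0 + s * 0))) :=
    ((((((h.const_add |t - s|)).add h).pow 2).add (h.const_mul t)).add (h.const_mul s)).const_mul _
  have h2 := le_of_tendsto_of_tendsto'
    (((hA.tendsto_eulerStep ht x).sub (hA.tendsto_eulerStep hs x)).norm.pow 2) h1 fun n =>
      hA.norm_eulerStep_sub_eulerStep_sq_le Nat.one_div_pos_of_nat Nat.one_div_pos_of_nat hξ ht hs
  rw [show ‖ξ‖ ^ 2 * ((|t - s| + 0 + 0) ^ 2 + t * 0 + s * 0) = (‖ξ‖ * |t - s|) ^ 2 by ring] at h2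
  exact pow_le_pow_iff_left₀ (norm_nonneg _) (by positivity) two_ne_zero |>.1 h2

/-- On the domain, the step counts for t and s add up to that for t + s, except for at most one step
lost to rounding, which costs l‖η‖. Density and continuity give the rest. -/
theorem semigroup_add {t s : ℝ} (ht : 0 ≤ t) (hs : 0 ≤ s) (x : H) :
    semigroup A (t + s) x = semigroup A s (semigroup A t x) := by
  refine congrFun (Continuous.ext_on hA.dense (hA.continuous_semigroup (add_nonneg ht hs))
    ((hA.continuous_semigroup hs).comp (hA.continuous_semigroup ht)) ?_) x
  rintro y ⟨η, hη⟩
  have hpos : ∀ n : ℕ, (0 : ℝ) < 1 / ((n : ℝ) + 1) := fun n => Nat.one_div_pos_of_nat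
  refine tendsto_nhds_unique (hA.tendsto_eulerStep (add_nonneg ht hs) y) ?_
  have h1 := hA.tendsto_eulerStep hs (semigroup A t y)
  rw [Function.comp_apply]
  rw [tendsto_iff_norm_sub_tendsto_zero] at h1 ⊢
  have h2 := tendsto_iff_norm_sub_tendsto_zero.1 (hA.tendsto_eulerStep ht y)
  have h3 := ((tendsto_one_div_add_atTop_nhds_zero_nat (𝕜 := ℝ)).mul_const ‖η‖).add (h2.add h1)
  rw [zero_mul, zero_add, zero_add] at h3
  refine squeeze_zero (fun _ => norm_nonneg _) (fun n => ?_) h3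
  set l := 1 / ((n : ℝ) + 1)
  have hl : 0 < l := hpos n
  have h4 : ‖eulerStep A l (t + s) y - eulerStep A l s (eulerStep A l t y)‖ ≤ l * ‖η‖ := by
    rw [eulerStep, eulerStep, eulerStep, ← Function.iterate_add_apply]
    have h5 : ⌊(t + s) / l⌋₊ = ⌊s / l⌋₊ + ⌊t / l⌋₊ ∨
        ⌊(t + s) / l⌋₊ = ⌊s / l⌋₊ + ⌊t / l⌋₊ + 1 := by
      have a1 := Nat.floor_le (div_nonneg ht hl.le)
      have a2 := Nat.lt_floor_add_one (t / l)
      have a3 := Nat.floor_le (div_nonneg hs hl.le)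
      have a4 := Nat.lt_floor_add_one (s / l)
      have a5 : ⌊s / l⌋₊ + ⌊t / l⌋₊ ≤ ⌊(t + s) / l⌋₊ := by
        apply Nat.le_floor; push_cast; rw [add_div]; linarith
      have a6 : ⌊(t + s) / l⌋₊ < ⌊s / l⌋₊ + ⌊t / l⌋₊ + 2 := by
        rw [Nat.floor_lt (by positivity)]; push_cast; rw [add_div]; linarith
      omega
    rcases h5 with h5 | h5
    · rw [h5, sub_self, norm_zero]; positivity
    · rw [h5, Function.iterate_succ_apply]
      refine (hA.norm_iterate_sub_le hl _ _ _).trans ?_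
      simpa using hA.norm_iterate_sub_self_le hl hη 1
  have h6 := hA.norm_eulerStep_sub_le hl s (eulerStep A l t y) (semigroup A t y)
  have h7 := norm_sub_le_norm_sub_add_norm_sub (eulerStep A l (t + s) y)
    (eulerStep A l s (eulerStep A l t y)) (semigroup A s (semigroup A t y))
  have h8 := norm_sub_le_norm_sub_add_norm_sub (eulerStep A l s (eulerStep A l t y))
    (eulerStep A l s (semigroup A t y)) (semigroup A s (semigroup A t y))
  linarith

theorem continuousOn_semigroup (x : H) : ContinuousOn (fun t => semigroup A t x) (Ici 0) := by
  intro t ht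
  rw [Metric.continuousWithinAt_iff]
  intro ε hε
  obtain ⟨y, hy, η, hη⟩ := Metric.dense_iff.1 hA.dense x (ε / 3) (by positivity)
  rw [Metric.mem_ball, dist_comm, dist_eq_norm] at hy
  refine ⟨ε / 3 / (‖η‖ + 1), by positivity, fun s hs hst => ?_⟩
  rw [dist_eq_norm] at hst ⊢
  rw [Real.norm_eq_abs, lt_div_iff₀ (by positivity)] at hst
  have h1 := hA.norm_semigroup_sub_semigroup_le hη hs ht
  have h2 := hA.norm_semigroup_sub_le hs x y
  have h3 := hA.norm_semigroup_sub_le ht y x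
  rw [norm_sub_rev y x] at h3
  have h4 := norm_sub_le_norm_sub_add_norm_sub (semigroup A s x) (semigroup A s y)
    (semigroup A t x)
  have h5 := norm_sub_le_norm_sub_add_norm_sub (semigroup A s y) (semigroup A t y)
    (semigroup A t x)
  nlinarith [abs_nonneg (s - t)]

/-! ### Smoothing effect and right differentiability. -/

omit [CompleteSpace H] in
-- Each Euler step lowers half the squared distance to y by at least l⟨η, q - y⟩, q being the new
-- iterate. Replacing q by x costs a drift of at most (n + 1)l‖ξ‖, and these costs add up to second
-- order in the elapsed time.
theorem iterate_deviation {l : ℝ} (hl : 0 < l) {x ξ y η : H} (hξ : ξ ∈ A x) (hη : η ∈ A y)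
    (n : ℕ) : ‖(resolvent A l)^[n] x - y‖ ^ 2 / 2 - ‖x - y‖ ^ 2 / 2 ≤
      -(n * l) * inner ℝ η (x - y) + (n * l) ^ 2 * (‖η‖ * ‖ξ‖) := by
  induction n with
  | zero => simp
  | succ n ih =>
    have h1 := hA.norm_iterate_sub_self_le hl hξ (n + 1)
    rw [Function.iterate_succ_apply'] at h1 ⊢
    set p := (resolvent A l)^[n] x
    have h2 := hA.monotone (hA.yosida_mem hl p) hη
    have h3 : p = resolvent A l p + l • yosida A l p := by rw [resolvent_eq hl]; abel
    set q := resolvent A l p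
    set ζ := yosida A l p
    have h4 : ‖p - y‖ ^ 2 = ‖q - y‖ ^ 2 + 2 * (l * inner ℝ ζ (q - y)) + ‖l • ζ‖ ^ 2 := by
      have : p - y = (q - y) + l • ζ := by rw [h3]; abel
      rw [this, norm_add_sq_real, inner_smul_right, real_inner_comm]
    have h5 : inner ℝ η (q - y) = inner ℝ η (x - y) + inner ℝ η (q - x) := by
      rw [← inner_add_right]; congr 1; abel
    have h6 := (abs_le.1 (abs_real_inner_le_norm η (q - x))).1
    have h7 : ‖η‖ * ‖q - x‖ ≤ ‖η‖ * (((n + 1 : ℕ) : ℝ) * l * ‖ξ‖) :=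
      mul_le_mul_of_nonneg_left h1 (norm_nonneg _)
    rw [inner_sub_left] at h2
    have h8 : l * (inner ℝ η (x - y) - ‖η‖ * (((n + 1 : ℕ) : ℝ) * l * ‖ξ‖)) ≤
        l * inner ℝ ζ (q - y) := mul_le_mul_of_nonneg_left (by linarith) hl.le
    have h9 : 0 ≤ (n : ℝ) * l ^ 2 * (‖η‖ * ‖ξ‖) := by positivity
    push_cast at h8 ⊢
    nlinarith [sq_nonneg ‖l • ζ‖]

omit [NormedAddCommGroup H] [InnerProductSpace ℝ H] hA [CompleteSpace H] in
theorem _root_.AnisoDiffusion.tendsto_floor_mul {t : ℝ} (ht : 0 ≤ t) :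
    Tendsto (fun n : ℕ => (⌊t / (1 / ((n : ℝ) + 1))⌋₊ : ℝ) * (1 / ((n : ℝ) + 1))) atTop (𝓝 t) := by
  have h : Tendsto (fun n : ℕ => t - 1 / ((n : ℝ) + 1)) atTop (𝓝 (t - 0)) :=
    tendsto_const_nhds.sub tendsto_one_div_add_atTop_nhds_zero_nat
  rw [sub_zero] at h
  refine tendsto_of_tendsto_of_tendsto_of_le_of_le h tendsto_const_nhds (fun n => ?_) fun n => ?_
  all_goals
    have hl : (0 : ℝ) < 1 / ((n : ℝ) + 1) := Nat.one_div_pos_of_nat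
    have h1 := Nat.floor_le (div_nonneg ht hl.le)
    have h2 := Nat.lt_floor_add_one (t / (1 / ((n : ℝ) + 1)))
    rw [le_div_iff₀ hl] at h1
    rw [div_lt_iff₀ hl] at h2
    dsimp only
    linarith

theorem semigroup_deviation {x ξ y η : H} (hξ : ξ ∈ A x) (hη : η ∈ A y) {h : ℝ} (hh : 0 ≤ h) :
    ‖semigroup A h x - y‖ ^ 2 / 2 - ‖x - y‖ ^ 2 / 2 ≤
      -h * inner ℝ η (x - y) + h ^ 2 * (‖η‖ * ‖ξ‖) := by
  have h1 := tendsto_floor_mul hh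
  have h2 := hA.tendsto_eulerStep hh x
  exact le_of_tendsto_of_tendsto' ((((h2.sub_const y).norm.pow 2).div_const 2).sub_const _)
    ((h1.neg.mul_const _).add ((h1.pow 2).mul_const _)) fun n =>
      hA.iterate_deviation Nat.one_div_pos_of_nat hξ hη _

omit [CompleteSpace H] in
/-- The discrete smoothing estimate. -/
theorem iterate_smoothing {l : ℝ} (hl : 0 < l) (x : H) (n : ℕ) :
    ‖(resolvent A l)^[n + 1] x‖ ^ 2 / 2 + (n + 1) * l * e ((resolvent A l)^[n + 1] x) +
      (n + 1) * n * l ^ 2 * ‖yosida A l ((resolvent A l)^[n] x)‖ ^ 2 / 2 ≤ ‖x‖ ^ 2 / 2 := by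
  have step : ∀ p : H, ‖resolvent A l p‖ ^ 2 / 2 + l * e (resolvent A l p) ≤ ‖p‖ ^ 2 / 2 := by
    intro p
    have h2 := hA.energy_le (hA.yosida_mem hl p) (Or.inl rfl)
    have h3 : p = resolvent A l p + l • yosida A l p := by rw [resolvent_eq hl]; abel
    set q := resolvent A l p
    set ζ := yosida A l p
    have h4 : ‖p‖ ^ 2 = ‖q‖ ^ 2 + 2 * (l * inner ℝ ζ q) + ‖l • ζ‖ ^ 2 := by
      rw [h3, norm_add_sq_real, inner_smul_right, real_inner_comm]
    rw [hA.energy_zero, zero_sub, inner_neg_right] at h2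
    nlinarith [sq_nonneg ‖l • ζ‖, mul_le_mul_of_nonneg_left h2 hl.le]
  induction n with
  | zero => simpa using step x
  | succ n ih =>
    rw [Function.iterate_succ_apply'] at ih ⊢
    have hiter : (resolvent A l)^[n + 1] x = resolvent A l ((resolvent A l)^[n] x) :=
      Function.iterate_succ_apply' _ _ _
    rw [hiter]
    set o := (resolvent A l)^[n] x
    set p := resolvent A l o
    have h1 := step p
    -- Energy dissipation over one step, used with weight (n + 1)l. It raises the coefficient of the
    -- squared speed from (n + 1)n/2 to (n + 2)(n + 1)/2, while `h4` says that the speed does not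
    -- increase.
    have h2 := hA.energy_le (hA.yosida_mem hl p) (Or.inr (hA.resolvent_mem_domain hl o))
    have h3 : resolvent A l o - resolvent A l p = l • yosida A l p := by
      rw [resolvent_eq hl p]; abel
    rw [h3, inner_smul_right, real_inner_self_eq_norm_sq] at h2
    have h4 : ‖yosida A l p‖ ≤ ‖yosida A l o‖ := hA.norm_yosida_le hl (hA.yosida_mem hl o)
    have h5 := pow_le_pow_left₀ (norm_nonneg _) h4 2
    have h6 : ((n : ℝ) + 1) * n * l ^ 2 * ‖yosida A l p‖ ^ 2 ≤
        ((n : ℝ) + 1) * n * l ^ 2 * ‖yosida A l o‖ ^ 2 :=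
      mul_le_mul_of_nonneg_left h5 (by positivity)
    have h7 : ((n : ℝ) + 1) * l * (e (resolvent A l p) + l * ‖yosida A l p‖ ^ 2) ≤
        ((n : ℝ) + 1) * l * e p := mul_le_mul_of_nonneg_left h2 (by positivity)
    push_cast
    nlinarith

/-- For fixed m the Yosida approximation is continuous, so the discrete smoothing bound survives the
limit although `A` itself need not be continuous. The bound does not depend on m. -/
theorem norm_yosida_semigroup_le {m : ℝ} (hm : 0 < m) {t : ℝ} (ht : 0 < t) (x : H) :
    ‖yosida A m (semigroup A t x)‖ ≤ ‖x‖ / t := by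
  have h1 := tendsto_floor_mul ht.le
  have h0 := tendsto_one_div_add_atTop_nhds_zero_nat (𝕜 := ℝ)
  have h2 := ((hA.continuous_yosida hm).tendsto _).comp (hA.tendsto_eulerStep ht.le x)
  have h3 := (h1.mul (h1.sub h0)).mul (h2.norm.pow 2)
  have h4 : t * (t - 0) * ‖yosida A m (semigroup A t x)‖ ^ 2 ≤ ‖x‖ ^ 2 := by
    refine le_of_tendsto' h3 fun n => ?_
    set l := 1 / ((n : ℝ) + 1)
    have hl : 0 < l := Nat.one_div_pos_of_nat
    simp only [Function.comp_apply, eulerStep]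
    rcases Nat.eq_zero_or_pos ⌊t / l⌋₊ with h5 | h5
    · rw [h5]; simp
    · obtain ⟨k, hk⟩ := Nat.exists_eq_succ_of_ne_zero h5.ne'
      rw [hk, Nat.succ_eq_add_one]
      have h6 := hA.iterate_smoothing hl x k
      have h7 : ‖yosida A m ((resolvent A l)^[k + 1] x)‖ ≤
          ‖yosida A l ((resolvent A l)^[k] x)‖ := by
        rw [Function.iterate_succ_apply']
        exact hA.norm_yosida_le hm (hA.yosida_mem hl _)
      have h8 := pow_le_pow_left₀ (norm_nonneg _) h7 2
      have h9 : ((k : ℝ) + 1) * k * l ^ 2 * ‖yosida A m ((resolvent A l)^[k + 1] x)‖ ^ 2 ≤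
          ((k : ℝ) + 1) * k * l ^ 2 * ‖yosida A l ((resolvent A l)^[k] x)‖ ^ 2 :=
        mul_le_mul_of_nonneg_left h8 (by positivity)
      have h10 : 0 ≤ ((k : ℝ) + 1) * l * e ((resolvent A l)^[k + 1] x) :=
        mul_nonneg (by positivity) (hA.energy_nonneg _)
      push_cast
      nlinarith [sq_nonneg ‖(resolvent A l)^[k + 1] x‖]
  rw [le_div_iff₀ ht]
  refine pow_le_pow_iff_left₀ (by positivity) (norm_nonneg _) two_ne_zero |>.1 ?_
  nlinarith

/-- Right differentiability at `0` of the semigroup at points of the domain. -/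
theorem hasDerivWithinAt_semigroup {x ξ : H} (hξ : ξ ∈ A x)
    (hlim : Tendsto (fun n : ℕ => yosida A (1 / ((n : ℝ) + 1)) x) atTop (𝓝 ξ))
    (hb : ∀ l, 0 < l → ‖yosida A l x - ξ‖ ^ 2 ≤ ‖ξ‖ ^ 2 - ‖yosida A l x‖ ^ 2) :
    HasDerivWithinAt (fun t => semigroup A t x) (-ξ) (Ici 0) 0 := by
  have key : ∀ h l : ℝ, 0 < h → 0 < l → ‖h⁻¹ • (semigroup A h x - x) + yosida A l x‖ ^ 2 ≤
      ‖ξ‖ ^ 2 - ‖yosida A l x‖ ^ 2 + 2 * h * ‖ξ‖ ^ 2 / l := by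
    intro h l hh hl
    -- Testing at the resolvent of x, where x - y = l • b, gives ⟨d, b⟩ ≤ -‖b‖² + h‖ξ‖²/l for the
    -- difference quotient d. Together with ‖d‖ ≤ ‖ξ‖ this bounds ‖d + b‖.
    have h1 := hA.semigroup_deviation hξ (hA.yosida_mem hl x) hh.le
    have h2 : ‖semigroup A h x - x‖ ≤ ‖ξ‖ * h := by
      have := hA.norm_semigroup_sub_semigroup_le hξ hh.le le_rfl
      rwa [hA.semigroup_zero, sub_zero, abs_of_pos hh] at this
    have h3 := hA.norm_yosida_le hl hξ
    rw [resolvent_eq hl] at h1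
    set b := yosida A l x
    obtain ⟨d, hd⟩ : ∃ d, semigroup A h x = x + h • d :=
      ⟨h⁻¹ • (semigroup A h x - x), by rw [smul_inv_smul₀ hh.ne']; abel⟩
    rw [hd] at h1 h2 ⊢
    rw [add_sub_cancel_left, norm_smul, Real.norm_of_nonneg hh.le, mul_comm] at h2
    have hd' : ‖d‖ ≤ ‖ξ‖ := le_of_mul_le_mul_right h2 hh
    have e1 : x + h • d - (x - l • b) = h • d + l • b := by abel
    rw [e1, sub_sub_cancel, norm_add_sq_real, inner_smul_left, inner_smul_right, inner_smul_right,
      real_inner_self_eq_norm_sq] at h1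
    simp only [conj_trivial] at h1
    rw [add_sub_cancel_left, inv_smul_smul₀ hh.ne', norm_add_sq_real]
    have h4 : h * l * (inner ℝ d b + ‖b‖ ^ 2) ≤ h ^ 2 * ‖ξ‖ ^ 2 := by
      have : ‖b‖ * ‖ξ‖ ≤ ‖ξ‖ ^ 2 := by nlinarith [norm_nonneg ξ]
      have := mul_le_mul_of_nonneg_left this (sq_nonneg h)
      nlinarith [sq_nonneg ‖h • d‖]
    have h5 : inner ℝ d b + ‖b‖ ^ 2 ≤ h * ‖ξ‖ ^ 2 / l := by
      rw [le_div_iff₀ hl]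
      refine le_of_mul_le_mul_left ?_ hh
      nlinarith
    have h6 : ‖d‖ ^ 2 ≤ ‖ξ‖ ^ 2 := pow_le_pow_left₀ (norm_nonneg _) hd' 2
    have h7 : 2 * h * ‖ξ‖ ^ 2 / l = 2 * (h * ‖ξ‖ ^ 2 / l) := by ring
    linarith
  rw [← hasDerivWithinAt_Ioi_iff_Ici, hasDerivWithinAt_iff_tendsto_slope' self_notMem_Ioi, Metric.tendsto_nhdsWithin_nhds]
  intro ε hε
  have h1 : Tendsto (fun n : ℕ => ‖ξ‖ ^ 2 - ‖yosida A (1 / ((n : ℝ) + 1)) x‖ ^ 2) atTop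
      (𝓝 (‖ξ‖ ^ 2 - ‖ξ‖ ^ 2)) := tendsto_const_nhds.sub (hlim.norm.pow 2)
  rw [sub_self] at h1
  -- The order matters: l is fixed first, so that ‖ξ‖² - ‖b‖² is small, and only then is h taken
  -- small relative to l.
  obtain ⟨n, hn⟩ := (h1.eventually (gt_mem_nhds (show 0 < (ε / 2) ^ 2 / 2 by positivity))).exists
  set l := 1 / ((n : ℝ) + 1)
  have hl : 0 < l := Nat.one_div_pos_of_nat
  refine ⟨(ε / 2) ^ 2 / 2 * l / (2 * (‖ξ‖ ^ 2 + 1)), by positivity, fun {h} hh hd => ?_⟩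
  have hh' : 0 < h := hh
  rw [Real.dist_eq, sub_zero, abs_of_pos hh', lt_div_iff₀ (by positivity)] at hd
  have h2 := key h l hh' hl
  have h3 : 2 * h * ‖ξ‖ ^ 2 / l < (ε / 2) ^ 2 / 2 := by
    rw [div_lt_iff₀ hl]; nlinarith
  have h4 : ‖h⁻¹ • (semigroup A h x - x) + yosida A l x‖ < ε / 2 :=
    lt_of_pow_lt_pow_left₀ 2 (by positivity) (by linarith)
  have h5 : ‖yosida A l x - ξ‖ < ε / 2 :=
    lt_of_pow_lt_pow_left₀ 2 (by positivity) (by nlinarith [hb l hl])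
  rw [dist_eq_norm, slope_def_module, sub_zero, hA.semigroup_zero]
  have e1 : h⁻¹ • (semigroup A h x - x) - -ξ =
      (h⁻¹ • (semigroup A h x - x) + yosida A l x) - (yosida A l x - ξ) := by abel
  rw [e1]
  exact (norm_sub_le _ _).trans_lt (by linarith)

/-- The smoothing bound ‖x‖/t puts the state at time t in the domain, and the semigroup law carries
the derivative at 0 over to t. -/
theorem rightInclusion_semigroup (x : H) {t : ℝ} (ht : 0 < t) :
    RightInclusion (minimalSection A) (fun s => semigroup A s x) t := by
  obtain ⟨ξ, hξ, hlim, hb⟩ := hA.exists_mem_minimalSection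
    fun l hl => hA.norm_yosida_semigroup_le hl ht x
  refine ⟨ξ, hξ, ?_⟩
  have h1 := hA.hasDerivWithinAt_semigroup hξ.1 hlim hb
  have h2 : HasDerivWithinAt (fun s => semigroup A (s - t) (semigroup A t x)) (-ξ) (Ici t) t := by
    have h3 : HasDerivWithinAt (fun s : ℝ => s - t) 1 (Ici t) t :=
      ((hasDerivAt_id t).sub_const t).hasDerivWithinAt
    have := HasDerivWithinAt.scomp_of_eq t h1 h3 (fun s hs => mem_Ici.2 (sub_nonneg.2 hs)) (sub_self t).symm
    simpa [Function.comp_def] using this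
  refine h2.congr (fun s hs => ?_) ?_
  · rw [← hA.semigroup_add ht.le (sub_nonneg.2 hs)]; congr 1; ring
  · rw [sub_self, hA.semigroup_zero]

end IsGradientOperator

end Semigroup

/-! ### Uniqueness by monotonicity. -/

section Uniqueness

variable {H : Type*} [NormedAddCommGroup H] [InnerProductSpace ℝ H]

theorem RightInclusion.mono {A B : H → Set H} (h : ∀ x, A x ⊆ B x) {u : ℝ → H} {t : ℝ}
    (hu : RightInclusion A u t) : RightInclusion B u t :=
  let ⟨ξ, hξ, hd⟩ := hu
  ⟨ξ, h _ hξ, hd⟩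

omit [InnerProductSpace ℝ H] in
theorem minimalSection_subset (A : H → Set H) (x : H) : minimalSection A x ⊆ A x :=
  fun _ h => h.1

theorem RightInclusion.hasDerivWithinAt_norm_sub_sq {A : H → Set H}
    (hA : ∀ {x y ξ η : H}, ξ ∈ A x → η ∈ A y → 0 ≤ inner ℝ (ξ - η) (x - y))
    {u v : ℝ → H} {t : ℝ} (hu : RightInclusion A u t) (hv : RightInclusion A v t) :
    ∃ c ≤ 0, HasDerivWithinAt (fun s => ‖u s - v s‖ ^ 2) c (Ici t) t := by
  obtain ⟨ξ, hξ, hu⟩ := hu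
  obtain ⟨η, hη, hv⟩ := hv
  refine ⟨_, ?_, (hu.sub hv).norm_sq⟩
  have h := hA hξ hη
  have e1 : -ξ - -η = -(ξ - η) := by abel
  rw [e1, inner_neg_right, Pi.sub_apply, real_inner_comm]
  linarith

omit [InnerProductSpace ℝ H] in
theorem eq_of_antitone_norm_sub {u v : ℝ → H} (hu : ContinuousOn u (Ici 0))
    (hv : ContinuousOn v (Ici 0)) (h0 : u 0 = v 0)
    (h : ∀ a b, 0 < a → a ≤ b → ‖u b - v b‖ ≤ ‖u a - v a‖) {t : ℝ} (ht : 0 ≤ t) : u t = v t := by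
  rcases ht.eq_or_lt with rfl | ht
  · exact h0
  have h1 : Tendsto (fun a => ‖u a - v a‖) (𝓝[Ioi 0] 0) (𝓝 ‖u 0 - v 0‖) :=
    ((hu 0 self_mem_Ici).sub (hv 0 self_mem_Ici)).norm.mono_left
      (nhdsWithin_mono 0 Ioi_subset_Ici_self)
  rw [h0, sub_self, norm_zero] at h1
  have h2 : ‖u t - v t‖ ≤ 0 := by
    refine ge_of_tendsto h1 ?_
    filter_upwards [Ioc_mem_nhdsGT ht] with a ha
    exact h a t ha.1 ha.2
  exact sub_eq_zero.1 (norm_le_zero_iff.1 h2)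

/-- The squared distance is continuous with nonpositive right derivative at every positive time,
hence nonincreasing there without any absolute continuity. -/
theorem IsPointwiseSolution.eq {A : H → Set H}
    (hA : ∀ {x y ξ η : H}, ξ ∈ A x → η ∈ A y → 0 ≤ inner ℝ (ξ - η) (x - y)) {u₀ : H}
    {u v : ℝ → H} (hu : IsPointwiseSolution A u₀ u) (hv : IsPointwiseSolution A u₀ v) {t : ℝ}
    (ht : 0 ≤ t) : u t = v t := by
  refine eq_of_antitone_norm_sub hu.continuousOn hv.continuousOn
    (hu.initial.trans hv.initial.symm) (fun a b ha hab => ?_) ht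
  have h1 : ∀ t, ∃ c, 0 < t → c ≤ 0 ∧ HasDerivWithinAt (fun s => ‖u s - v s‖ ^ 2) c (Ici t) t := by
    intro t
    by_cases h : 0 < t
    · obtain ⟨c, hc, hd⟩ := RightInclusion.hasDerivWithinAt_norm_sub_sq hA
        (hu.inclusion t h) (hv.inclusion t h)
      exact ⟨c, fun _ => ⟨hc, hd⟩⟩
    -- An arbitrary value at nonpositive times, needed only to make c a total function.
    · exact ⟨0, fun h' => absurd h' h⟩
  choose c hc using h1
  have hsub : Icc a b ⊆ Ici 0 := fun s hs => ha.le.trans hs.1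
  have h2 := image_le_of_deriv_right_le_deriv_boundary (f := fun s => ‖u s - v s‖ ^ 2) (f' := c)
    (B := fun _ => ‖u a - v a‖ ^ 2) (B' := fun _ => 0) (a := a) (b := b)
    (((hu.continuousOn.mono hsub).sub (hv.continuousOn.mono hsub)).norm.pow 2)
    (fun x hx => (hc x (ha.trans_le hx.1)).2) le_rfl continuousOn_const
    (fun x _ => hasDerivWithinAt_const _ _ _) (fun x hx => (hc x (ha.trans_le hx.1)).1)
    (right_mem_Icc.2 hab)
  exact pow_le_pow_iff_left₀ (norm_nonneg _) (norm_nonneg _) two_ne_zero |>.1 h2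

omit [InnerProductSpace ℝ H] in
theorem _root_.AbsolutelyContinuousOnInterval.norm {f : ℝ → H} {a b : ℝ}
    (hf : AbsolutelyContinuousOnInterval f a b) :
    AbsolutelyContinuousOnInterval (fun t => ‖f t‖) a b :=
  squeeze_zero (fun _ => Finset.sum_nonneg fun _ _ => dist_nonneg)
    (fun _ => Finset.sum_le_sum fun _ _ =>
      (dist_norm_norm_le _ _).trans_eq (dist_eq_norm _ _).symm) hf

/-- The real function ‖u - v‖² is absolutely continuous, so it is the integral of its derivative,
which almost everywhere agrees with the nonpositive right derivative. Differentiability of the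
solutions themselves beyond the right derivative is not needed. -/
theorem IsStrongSolution.eq {A : H → Set H}
    (hA : ∀ {x y ξ η : H}, ξ ∈ A x → η ∈ A y → 0 ≤ inner ℝ (ξ - η) (x - y)) {u₀ : H}
    {u v : ℝ → H} (hu : IsStrongSolution A u₀ u) (hv : IsStrongSolution A u₀ v) {t : ℝ}
    (ht : 0 ≤ t) : u t = v t := by
  refine eq_of_antitone_norm_sub hu.continuousOn hv.continuousOn
    (hu.initial.trans hv.initial.symm) (fun a b ha hab => ?_) ht
  have h1 := ((hu.absolutelyContinuous a b ha hab).sub (hv.absolutelyContinuous a b ha hab)).norm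
  have h2 : AbsolutelyContinuousOnInterval (fun t => ‖u t - v t‖ ^ 2) a b := by
    have := h1.mul h1
    convert this using 1
    ext s
    simp [sq]
  have h3 := h2.integral_deriv_eq_sub
  have h4 : (∫ s in a..b, deriv (fun t => ‖u t - v t‖ ^ 2) s) ≤ ∫ s in a..b, (0 : ℝ) := by
    refine intervalIntegral.integral_mono_ae_restrict hab h2.intervalIntegrable_deriv
      intervalIntegrable_const ?_
    rw [EventuallyLE, ae_restrict_iff' measurableSet_Icc]
    filter_upwards [hu.inclusion, hv.inclusion, h2.ae_differentiableAt] with s hus hvs hds hs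
    have hs0 : 0 < s := ha.trans_le hs.1
    obtain ⟨c, hc, hd⟩ := RightInclusion.hasDerivWithinAt_norm_sub_sq hA (hus hs0) (hvs hs0)
    rw [uIcc_of_le hab] at hds
    have h5 := (uniqueDiffWithinAt_Ici s).eq_deriv _ (hds hs).hasDerivAt.hasDerivWithinAt hd
    rw [h5]
    exact hc
  rw [intervalIntegral.integral_zero, h3] at h4
  exact pow_le_pow_iff_left₀ (norm_nonneg _) (norm_nonneg _) two_ne_zero |>.1 (by linarith)

end Uniqueness

/-! ### Well-posedness for the abstract gradient flow. -/

section Existence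

variable {H : Type*} [NormedAddCommGroup H] [InnerProductSpace ℝ H] [CompleteSpace H]
  {A : H → Set H} {e : H → ℝ}

namespace IsGradientOperator

variable (hA : IsGradientOperator A e) (u₀ : H)
include hA

theorem isPointwiseSolution_semigroup :
    IsPointwiseSolution A u₀ fun t => semigroup A t u₀ where
  continuousOn := hA.continuousOn_semigroup u₀
  initial := hA.semigroup_zero u₀
  inclusion _ ht := (hA.rightInclusion_semigroup u₀ ht).mono (minimalSection_subset A)

/-- After any time a > 0 the state is in the domain, so from then on the trajectory is Lipschitz. -/
theorem isStrongSolution_semigroup :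
    IsStrongSolution A u₀ fun t => semigroup A t u₀ where
  continuousOn := hA.continuousOn_semigroup u₀
  initial := hA.semigroup_zero u₀
  inclusion := Eventually.of_forall fun t ht =>
    (hA.isPointwiseSolution_semigroup u₀).inclusion t ht
  absolutelyContinuous a b ha hab := by
    obtain ⟨ξ, hξ, -⟩ := hA.rightInclusion_semigroup u₀ ha
    refine LipschitzOnWith.absolutelyContinuousOnInterval (K := ‖ξ‖₊)
      (LipschitzOnWith.of_dist_le_mul fun s hs t ht => ?_)
    rw [uIcc_of_le hab] at hs ht
    have h1 := hA.norm_semigroup_sub_semigroup_le hξ.1 (sub_nonneg.2 hs.1) (sub_nonneg.2 ht.1)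
    rw [← hA.semigroup_add ha.le (sub_nonneg.2 hs.1), ← hA.semigroup_add ha.le
      (sub_nonneg.2 ht.1)] at h1
    simpa [dist_eq_norm] using h1

/-- Well-posedness and smoothing effect of the gradient flow for all initial data. -/
theorem exists_solution : ∃ u : ℝ → H, IsPointwiseSolution A u₀ u ∧ IsStrongSolution A u₀ u ∧
    (∀ v, (IsPointwiseSolution A u₀ v ∨ IsStrongSolution A u₀ v) → ∀ t, 0 ≤ t → v t = u t) ∧
    ∀ t, 0 < t → u t ∈ domain A ∧ RightInclusion (minimalSection A) u t := by
  refine ⟨fun t => semigroup A t u₀, hA.isPointwiseSolution_semigroup u₀,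
    hA.isStrongSolution_semigroup u₀, fun v hv t ht => ?_, fun t ht => ?_⟩
  · rcases hv with hv | hv
    · exact hv.eq hA.monotone (hA.isPointwiseSolution_semigroup u₀) ht
    · exact hv.eq hA.monotone (hA.isStrongSolution_semigroup u₀) ht
  · have h := hA.rightInclusion_semigroup u₀ ht
    obtain ⟨ξ, hξ, -⟩ := id h
    exact ⟨⟨ξ, hξ.1⟩, h⟩

end IsGradientOperator

end Existence

/-! ### Minimization and proximal problems for convex functionals. -/

/-- A uniformly midpoint convex function with closed sublevel sets attains its minimum. -/
theorem exists_minimizer {X : Type*} [MetricSpace X] [CompleteSpace X] {K : Set X} {F : X → ℝ}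
    (hK : K.Nonempty) (hF : ∀ p ∈ K, 0 ≤ F p) {c : ℝ} (hc : 0 < c)
    (hmid : ∀ p ∈ K, ∀ q ∈ K, ∃ r ∈ K, F r + c * dist p q ^ 2 ≤ (F p + F q) / 2)
    (hcl : ∀ a, IsClosed {p | p ∈ K ∧ F p ≤ a}) : ∃ p ∈ K, ∀ q ∈ K, F p ≤ F q := by
  set m := sInf (F '' K) with hm
  have hbdd : BddBelow (F '' K) := ⟨0, by rintro _ ⟨p, hp, rfl⟩; exact hF p hp⟩
  have hle : ∀ p ∈ K, m ≤ F p := fun p hp => csInf_le hbdd ⟨p, hp, rfl⟩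
  have hex : ∀ n : ℕ, ∃ p ∈ K, F p < m + 1 / ((n : ℝ) + 1) := by
    intro n
    obtain ⟨_, ⟨p, hp, rfl⟩, h⟩ := exists_lt_of_csInf_lt (hK.image F)
      (show sInf (F '' K) < m + 1 / ((n : ℝ) + 1) from
        lt_add_of_pos_right _ Nat.one_div_pos_of_nat)
    exact ⟨p, hp, h⟩
  choose p hpK hp using hex
  have h0 := tendsto_one_div_add_atTop_nhds_zero_nat (𝕜 := ℝ)
  -- The midpoint of two almost-minimizers cannot go below the infimum, so the convexity gain
  -- c·dist² is at most their excess.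
  have hcs : CauchySeq p := by
    rw [Metric.cauchySeq_iff']
    intro ε hε
    obtain ⟨N, hN⟩ := (h0.eventually (gt_mem_nhds (show 0 < c * ε ^ 2 by positivity))).exists
    refine ⟨N, fun n hn => ?_⟩
    obtain ⟨r, hr, h1⟩ := hmid _ (hpK n) _ (hpK N)
    have h2 := hle r hr
    have h3 : 1 / ((n : ℝ) + 1) ≤ 1 / ((N : ℝ) + 1) := Nat.one_div_le_one_div hn
    have h4 := hp n
    have h5 := hp N
    have h6 : c * dist (p n) (p N) ^ 2 < c * ε ^ 2 := by linarith
    exact lt_of_pow_lt_pow_left₀ 2 hε.le (lt_of_mul_lt_mul_left h6 hc.le)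
  obtain ⟨q, hq⟩ := cauchySeq_tendsto_of_complete hcs
  have hmem : ∀ N : ℕ, q ∈ K ∧ F q ≤ m + 1 / ((N : ℝ) + 1) := fun N =>
    (hcl _).mem_of_tendsto hq (eventually_atTop.2 ⟨N, fun n hn => ⟨hpK n, (hp n).le.trans
      (add_le_add_right (Nat.one_div_le_one_div hn) m)⟩⟩)
  have h1 : F q ≤ m + 0 := ge_of_tendsto' (h0.const_add m) fun N => (hmem N).2
  exact ⟨q, (hmem 0).1, fun r hr => (h1.trans_eq (add_zero m)).trans (hle r hr)⟩

section Functional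

variable {H : Type*} [NormedAddCommGroup H] [InnerProductSpace ℝ H]

/-- A densely defined nonnegative convex functional vanishing at `0` all of whose proximal
problems are solvable. -/
structure IsProximal (φ : H → EReal) : Prop where
  nonneg : ∀ x, 0 ≤ φ x
  zero : φ 0 = 0
  convex : ∀ {x y : H}, φ x ≠ ⊤ → φ y ≠ ⊤ → ∀ {t : ℝ}, 0 < t → t < 1 →
    φ ((1 - t) • x + t • y) ≤ (((1 - t) * (φ x).toReal + t * (φ y).toReal : ℝ) : EReal)
  minimizer : ∀ {l : ℝ}, 0 < l → ∀ f : H, ∃ u, φ u ≠ ⊤ ∧ ∀ w, φ w ≠ ⊤ →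
    (φ u).toReal + ‖u - f‖ ^ 2 / (2 * l) ≤ (φ w).toReal + ‖w - f‖ ^ 2 / (2 * l)
  dense : Dense {x | φ x ≠ ⊤}

namespace IsProximal

variable {φ : H → EReal} (hφ : IsProximal φ)
include hφ

theorem coe_toReal {x : H} (hx : φ x ≠ ⊤) : ((φ x).toReal : EReal) = φ x :=
  EReal.coe_toReal hx (ne_bot_of_le_ne_bot (by simp) (hφ.nonneg x))

theorem mem_subdifferential_iff {x ξ : H} : ξ ∈ subdifferential φ x ↔ φ x ≠ ⊤ ∧
    ∀ y, φ y ≠ ⊤ → (φ x).toReal + inner ℝ ξ (y - x) ≤ (φ y).toReal := by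
  refine and_congr_right fun hx => forall_congr' fun y => ?_
  by_cases hy : φ y = ⊤
  · simp [hy]
  · rw [← hφ.coe_toReal hx, ← hφ.coe_toReal hy]
    simp only [EReal.toReal_coe, ne_eq, EReal.coe_ne_top, not_false_eq_true, true_implies]
    norm_cast

/-- The Euler-Lagrange inequality: compare u with points of the segment from u to w, divide by t and
let t tend to 0. -/
theorem exists_proximal_point {l : ℝ} (hl : 0 < l) (f : H) :
    ∃ u, l⁻¹ • (f - u) ∈ subdifferential φ u ∧ ∀ w, φ w ≠ ⊤ →
    (φ u).toReal + ‖u - f‖ ^ 2 / (2 * l) ≤ (φ w).toReal + ‖w - f‖ ^ 2 / (2 * l) := by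
  obtain ⟨u, hu, hmin⟩ := hφ.minimizer hl f
  refine ⟨u, hφ.mem_subdifferential_iff.2 ⟨hu, fun w hw => ?_⟩, hmin⟩
  have key : ∀ t : ℝ, 0 < t → t < 1 → (φ u).toReal - (φ w).toReal + l⁻¹ * inner ℝ (f - u) (w - u) ≤
      t * (‖w - u‖ ^ 2 / (2 * l)) := by
    intro t ht0 ht1
    have h1 := hφ.convex hu hw ht0 ht1
    have h2 : φ ((1 - t) • u + t • w) ≠ ⊤ := (h1.trans_lt (EReal.coe_lt_top _)).ne
    have h3 := hmin _ h2
    rw [← hφ.coe_toReal h2, EReal.coe_le_coe_iff] at h1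
    have e1 : (1 - t) • u + t • w - f = t • (w - u) - (f - u) := by module
    rw [e1, norm_sub_sq_real (t • (w - u)), inner_smul_left, norm_smul,
      Real.norm_of_nonneg ht0.le, norm_sub_rev u f, real_inner_comm] at h3
    simp only [conj_trivial] at h3
    have h4 : t * ((φ u).toReal - (φ w).toReal + l⁻¹ * inner ℝ (f - u) (w - u)) ≤
        t * (t * (‖w - u‖ ^ 2 / (2 * l))) := by
      have e2 : ((t * ‖w - u‖) ^ 2 - 2 * (t * inner ℝ (f - u) (w - u)) + ‖f - u‖ ^ 2) / (2 * l) =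
        t * (t * (‖w - u‖ ^ 2 / (2 * l))) - t * (l⁻¹ * inner ℝ (f - u) (w - u)) +
          ‖f - u‖ ^ 2 / (2 * l) := by
        field_simp
      rw [e2] at h3
      nlinarith
    exact le_of_mul_le_mul_left h4 ht0
  have h5 : Tendsto (fun t : ℝ => t * (‖w - u‖ ^ 2 / (2 * l))) (𝓝[Ioi 0] 0)
      (𝓝 (0 * (‖w - u‖ ^ 2 / (2 * l)))) :=
    (tendsto_id.mul_const _).mono_left nhdsWithin_le_nhds
  rw [zero_mul] at h5
  have h6 : (φ u).toReal - (φ w).toReal + l⁻¹ * inner ℝ (f - u) (w - u) ≤ 0 := by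
    refine ge_of_tendsto h5 ?_
    filter_upwards [Ioo_mem_nhdsGT (zero_lt_one (α := ℝ))] with t ht
    exact key t ht.1 ht.2
  rw [inner_smul_left]
  simp only [conj_trivial]
  linarith

theorem isGradientOperator : IsGradientOperator (subdifferential φ) fun x => (φ x).toReal where
  monotone {x y ξ η} hξ hη := by
    rw [hφ.mem_subdifferential_iff] at hξ hη
    have h1 := hξ.2 y hη.1
    have h2 := hη.2 x hξ.1
    have e1 : inner ℝ ξ (y - x) = -inner ℝ ξ (x - y) := by rw [← inner_neg_right, neg_sub]
    rw [inner_sub_left]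
    linarith
  surjective l hl f := (hφ.exists_proximal_point hl f).imp fun _ h => h.1
  energy_nonneg x := EReal.toReal_nonneg (hφ.nonneg x)
  energy_zero := by rw [hφ.zero, EReal.toReal_zero]
  energy_le {x y ξ} hξ hy := by
    -- Finiteness at y is essential here, since `EReal.toReal` sends ⊤ to 0.
    refine (hφ.mem_subdifferential_iff.1 hξ).2 y ?_
    rcases hy with rfl | ⟨η, hη⟩
    · rw [hφ.zero]; exact EReal.zero_ne_top
    · exact hη.1
  dense := by
    refine dense_closure.1 (Dense.mono (fun x hx => ?_) hφ.dense)
    rw [Metric.mem_closure_iff]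
    intro ε hε
    have hx0 := EReal.toReal_nonneg (hφ.nonneg x)
    -- Comparing the proximal point u with x itself gives ‖u - x‖² ≤ 2 l φ(x), which this l keeps
    -- below ε².
    set l := ε ^ 2 / (4 * ((φ x).toReal + 1)) with hl
    have hlpos : 0 < l := by positivity
    obtain ⟨u, hu, hmin⟩ := hφ.exists_proximal_point hlpos x
    refine ⟨u, ⟨_, hu⟩, ?_⟩
    have h1 := hmin x hx
    have hu0 := EReal.toReal_nonneg (hφ.nonneg u)
    rw [sub_self, norm_zero] at h1
    have h2 : ‖u - x‖ ^ 2 / (2 * l) ≤ (φ x).toReal := by norm_num at h1; linarith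
    rw [div_le_iff₀ (by positivity)] at h2
    rw [dist_comm, dist_eq_norm]
    refine lt_of_pow_lt_pow_left₀ 2 hε.le (h2.trans_lt ?_)
    rw [hl]
    have : (φ x).toReal * (2 * (ε ^ 2 / (4 * ((φ x).toReal + 1)))) =
        ε ^ 2 / 2 * ((φ x).toReal / ((φ x).toReal + 1)) := by field_simp; norm_num
    rw [this]
    have h3 : (φ x).toReal / ((φ x).toReal + 1) ≤ 1 := by
      rw [div_le_one (by positivity)]; linarith
    have h4 : 0 < ε ^ 2 := by positivity
    nlinarith

end IsProximal

theorem norm_midpoint_sub_sq (p q f : H) :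
    ‖(1 / 2 : ℝ) • p + (1 / 2 : ℝ) • q - f‖ ^ 2 =
      (‖p - f‖ ^ 2 + ‖q - f‖ ^ 2) / 2 - ‖p - q‖ ^ 2 / 4 := by
  have h := parallelogram_law_with_norm ℝ (p - f) (q - f)
  have e1 : (1 / 2 : ℝ) • p + (1 / 2 : ℝ) • q - f = (1 / 2 : ℝ) • ((p - f) + (q - f)) := by module
  rw [sub_sub_sub_cancel_right] at h
  rw [e1, norm_smul]
  norm_num
  nlinarith

/-- A supremum of bounded linear functionals has solvable proximal problems. -/
theorem isProximal_of_le_iff [CompleteSpace H] {φ : H → EReal} {E : Set H} (h0 : (0 : H) ∈ E)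
    (h : ∀ (u : H) (c : ℝ), φ u ≤ c ↔ ∀ w ∈ E, inner ℝ w u ≤ c) (hd : Dense {x | φ x ≠ ⊤}) :
    IsProximal φ := by
  have hnn : ∀ x, 0 ≤ φ x := by
    intro x
    by_contra hlt
    push Not at hlt
    obtain ⟨c, hc1, hc2⟩ := EReal.lt_iff_exists_real_btwn.1 hlt
    have := (h x c).1 hc1.le 0 h0
    rw [inner_zero_left] at this
    exact absurd hc2 (not_lt.2 (EReal.coe_nonneg.2 this))
  have hcoe : ∀ {x}, φ x ≠ ⊤ → ((φ x).toReal : EReal) = φ x := fun {x} hx =>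
    EReal.coe_toReal hx (ne_bot_of_le_ne_bot (by simp) (hnn x))
  have hle : ∀ {x}, φ x ≠ ⊤ → ∀ w ∈ E, inner ℝ w x ≤ (φ x).toReal := fun {x} hx =>
    (h x _).1 (hcoe hx).ge
  have hiff : ∀ x c, (φ x ≠ ⊤ ∧ (φ x).toReal ≤ c) ↔ ∀ w ∈ E, inner ℝ w x ≤ c := by
    intro x c
    rw [← h]
    constructor
    · rintro ⟨h1, h2⟩
      rw [← hcoe h1]; exact_mod_cast h2
    · intro h1
      have h2 : φ x ≠ ⊤ := (h1.trans_lt (EReal.coe_lt_top _)).ne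
      refine ⟨h2, ?_⟩
      rw [← hcoe h2] at h1; exact_mod_cast h1
  have hzero : φ 0 = 0 := le_antisymm (by
    have := (h 0 0).2 fun w _ => by rw [inner_zero_right]
    simpa using this) (hnn 0)
  have hconv : ∀ {x y : H}, φ x ≠ ⊤ → φ y ≠ ⊤ → ∀ {t : ℝ}, 0 < t → t < 1 →
      φ ((1 - t) • x + t • y) ≤ (((1 - t) * (φ x).toReal + t * (φ y).toReal : ℝ) : EReal) := by
    intro x y hx hy t ht0 ht1
    rw [h]
    intro w hw
    rw [inner_add_right, inner_smul_right, inner_smul_right]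
    exact add_le_add (mul_le_mul_of_nonneg_left (hle hx w hw) (by linarith))
      (mul_le_mul_of_nonneg_left (hle hy w hw) ht0.le)
  refine ⟨hnn, hzero, hconv, fun {l} hl f => ?_, hd⟩
  refine exists_minimizer (K := {x | φ x ≠ ⊤})
    (F := fun u => (φ u).toReal + ‖u - f‖ ^ 2 / (2 * l)) ⟨0, by simp [hzero]⟩
    (fun p _ => add_nonneg (EReal.toReal_nonneg (hnn p)) (by positivity))
    -- The parallelogram law gains ‖p - q‖²/4, divided by the 2l of the penalty.
    (c := 1 / (8 * l)) (by positivity) (fun p hp q hq => ?_) fun a => ?_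
  · have h1 := hconv hp hq (t := 1 / 2) (by norm_num) (by norm_num)
    rw [show (1 - 1 / 2 : ℝ) = 1 / 2 by norm_num] at h1
    have h2 : φ ((1 / 2 : ℝ) • p + (1 / 2 : ℝ) • q) ≠ ⊤ := (h1.trans_lt (EReal.coe_lt_top _)).ne
    refine ⟨_, h2, ?_⟩
    rw [← hcoe h2, EReal.coe_le_coe_iff] at h1
    rw [norm_midpoint_sub_sq, dist_eq_norm]
    have e1 : ((‖p - f‖ ^ 2 + ‖q - f‖ ^ 2) / 2 - ‖p - q‖ ^ 2 / 4) / (2 * l) =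
      (‖p - f‖ ^ 2 / (2 * l) + ‖q - f‖ ^ 2 / (2 * l)) / 2 - 1 / (8 * l) * ‖p - q‖ ^ 2 := by
      field_simp; ring
    linarith
  -- The sublevel set is an intersection over `E` of sublevel sets of continuous functions; this is
  -- the lower semicontinuity of a supremum.
  · have e1 : {p | p ∈ {x | φ x ≠ ⊤} ∧ (φ p).toReal + ‖p - f‖ ^ 2 / (2 * l) ≤ a} =
        ⋂ w ∈ E, {p | inner ℝ w p + ‖p - f‖ ^ 2 / (2 * l) ≤ a} := by
      ext p
      have := hiff p (a - ‖p - f‖ ^ 2 / (2 * l))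
      simp only [Set.mem_ofPred_eq, mem_iInter, le_sub_iff_add_le] at this ⊢
      exact this
    rw [e1]
    refine isClosed_biInter fun w _ => isClosed_le ?_ continuous_const
    fun_prop

end Functional

/-! ### Test functions: integration by parts and density. -/

section TestFunctions

/-- Smooth functions with compact support contained in `Ω`. -/
structure IsTestFunction (Ω : Set Plane) (φ : Plane → ℝ) : Prop where
  contDiff : ContDiff ℝ ∞ φ
  compact : HasCompactSupport φ
  support : tsupport φ ⊆ Ω

variable {Ω : Set Plane}

theorem continuous_partialDeriv {φ : Plane → ℝ} (h : ContDiff ℝ 1 φ) (i : Fin 2) :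
    Continuous (partialDeriv i φ) :=
  (h.continuous_fderiv one_ne_zero).clm_apply continuous_const

theorem hasCompactSupport_partialDeriv {φ : Plane → ℝ} (h : HasCompactSupport φ) (i : Fin 2) :
    HasCompactSupport (partialDeriv i φ) :=
  h.fderiv_apply (𝕜 := ℝ) _

theorem integral_mul_partialDeriv {φ ψ : Plane → ℝ} (hφ : ContDiff ℝ 1 φ)
    (hc : HasCompactSupport φ) (hψ : ContDiff ℝ 1 ψ) (i : Fin 2) :
    ∫ x, φ x * partialDeriv i ψ x = -∫ x, partialDeriv i φ x * ψ x := by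
  refine integral_mul_fderiv_eq_neg_fderiv_mul_of_integrable ?_ ?_ ?_
    (fun x _ => hφ.differentiable one_ne_zero x) fun x _ => hψ.differentiable one_ne_zero x
  · exact ((continuous_partialDeriv hφ i).mul hψ.continuous).integrable_of_hasCompactSupport
      (hasCompactSupport_partialDeriv hc i).mul_right
  · exact (hφ.continuous.mul (continuous_partialDeriv hψ i)).integrable_of_hasCompactSupport
      hc.mul_right
  · exact (hφ.continuous.mul hψ.continuous).integrable_of_hasCompactSupport hc.mul_right

theorem partialDeriv_eq_zero {φ : Plane → ℝ} {x : Plane} (hx : x ∉ tsupport φ) (i : Fin 2) :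
    partialDeriv i φ x = 0 := by
  have h : fderiv ℝ φ x = 0 :=
    image_eq_zero_of_notMem_tsupport fun h => hx (tsupport_fderiv_subset ℝ h)
  rw [partialDeriv, h, zero_apply]

theorem setIntegral_mul_partialDeriv {φ ψ : Plane → ℝ} (hφ : ContDiff ℝ 1 φ)
    (hc : HasCompactSupport φ) (hs : tsupport φ ⊆ Ω) (hψ : ContDiff ℝ 1 ψ) (i : Fin 2) :
    ∫ x in Ω, φ x * partialDeriv i ψ x = -∫ x in Ω, partialDeriv i φ x * ψ x := by
  rw [setIntegral_eq_integral_of_forall_compl_eq_zero, integral_mul_partialDeriv hφ hc hψ i,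
    setIntegral_eq_integral_of_forall_compl_eq_zero]
  · intro x hx
    rw [partialDeriv_eq_zero (fun h => hx (hs h)), zero_mul]
  · intro x hx
    rw [image_eq_zero_of_notMem_tsupport fun h => hx (hs h), zero_mul]

/-- Representing pairings by inner products makes linearity and continuity in u automatic later on.
-/
theorem exists_inner_eq_integral {ψ : Plane → ℝ} (hψ : MemLp ψ 2 (volume.restrict Ω)) :
    ∃ w : L2 Ω, ∀ u : L2 Ω, ∫ x in Ω, u x * ψ x = inner ℝ w u := by
  refine ⟨hψ.toLp ψ, fun u => ?_⟩
  rw [L2.inner_def]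
  refine integral_congr_ae ?_
  filter_upwards [hψ.coeFn_toLp] with x hx
  simp [hx]

theorem memLp_of_hasCompactSupport {E : Type*} [NormedAddCommGroup E] {ψ : Plane → E}
    (hψ : Continuous ψ) (hc : HasCompactSupport ψ) : MemLp ψ 2 (volume.restrict Ω) :=
  hψ.memLp_of_hasCompactSupport hc

variable (Ω) in
/-- The subspace of `L²(Ω)` of classes of test functions. -/
def testFunctionClasses : Submodule ℝ (L2 Ω) where
  carrier := {u | ∃ φ, IsTestFunction Ω φ ∧ u =ᵐ[volume.restrict Ω] φ}
  zero_mem' := ⟨0, ⟨contDiff_const, .zero, by simp [tsupport]⟩, Lp.coeFn_zero ..⟩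
  add_mem' := by
    rintro u v ⟨φ, hφ, hu⟩ ⟨ψ, hψ, hv⟩
    exact ⟨φ + ψ, ⟨hφ.contDiff.add hψ.contDiff, hφ.compact.add hψ.compact,
      (tsupport_add φ ψ).trans (union_subset hφ.support hψ.support)⟩,
      (Lp.coeFn_add u v).trans (hu.add hv)⟩
  smul_mem' := by
    rintro c u ⟨φ, hφ, hu⟩
    exact ⟨c • φ, ⟨hφ.contDiff.const_smul c, hφ.compact.smul_left (f := fun _ => c),
      (closure_mono (Function.support_const_smul_subset c φ)).trans hφ.support⟩,
      (Lp.coeFn_smul c u).trans (hu.const_smul c)⟩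

/-- An element orthogonal to all test functions vanishes by the fundamental lemma of the calculus of
variations. -/
theorem dense_testFunctionClasses (hΩ : IsOpen Ω) :
    Dense (testFunctionClasses Ω : Set (L2 Ω)) := by
  rw [Submodule.dense_iff_topologicalClosure_eq_top, Submodule.topologicalClosure_eq_top_iff,
    Submodule.eq_bot_iff]
  intro u hu
  have hloc : LocallyIntegrableOn u Ω :=
    locallyIntegrableOn_of_locallyIntegrable_restrict
      ((Lp.memLp u).locallyIntegrable (by norm_num))
  have h : ∀ᵐ x, x ∈ Ω → u x = 0 := by
    refine hΩ.ae_eq_zero_of_integral_contDiff_smul_eq_zero hloc fun φ hφ hc hs => ?_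
    have hm : MemLp φ 2 (volume.restrict Ω) := memLp_of_hasCompactSupport hφ.continuous hc
    have h1 := hu (hm.toLp φ) ⟨φ, ⟨hφ, hc, hs⟩, hm.coeFn_toLp⟩
    rw [L2.inner_def] at h1
    rw [← setIntegral_eq_integral_of_forall_compl_eq_zero (s := Ω), ← h1]
    · refine integral_congr_ae ?_
      filter_upwards [hm.coeFn_toLp] with x hx
      simp [hx, mul_comm]
    · intro x hx
      rw [image_eq_zero_of_notMem_tsupport fun h => hx (hs h), zero_smul]
  refine Lp.ext ?_
  rw [EventuallyEq, ae_restrict_iff' hΩ.measurableSet]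
  have h2 := (ae_restrict_iff' hΩ.measurableSet).1 (Lp.coeFn_zero ℝ 2 (volume.restrict Ω))
  filter_upwards [h, h2] with x h1 h2 hx
  rw [h1 hx, h2 hx, Pi.zero_apply]

end TestFunctions

/-! ### The anisotropic total variation `Phi0`. -/

section TotalVariation

variable {Ω : Set Plane}

theorem contDiff_coord {z : Plane → Plane} (hz : ContDiff ℝ 1 z) (i : Fin 2) :
    ContDiff ℝ 1 fun y => z y i :=
  contDiff_euclidean.1 hz i

theorem hasCompactSupport_coord {z : Plane → Plane} (hz : HasCompactSupport z) (i : Fin 2) :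
    HasCompactSupport fun y => z y i :=
  hz.comp_left (g := fun y : Plane => y i) rfl

theorem memLp_divergence {z : Plane → Plane} (hz : IsTestField Ω z) :
    MemLp (divergence z) 2 (volume.restrict Ω) := by
  have h : ∀ i : Fin 2, MemLp (partialDeriv i fun y => z y i) 2 (volume.restrict Ω) := fun i =>
    memLp_of_hasCompactSupport (continuous_partialDeriv (contDiff_coord hz.contDiff i) i)
      (hasCompactSupport_partialDeriv (hasCompactSupport_coord hz.compact i) i)
  exact memLp_finsetSum _ fun i _ => h i

theorem exists_inner_eq_gradPairing {z : Plane → Plane} (hz : IsTestField Ω z) :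
    ∃ w : L2 Ω, ∀ u, gradPairing Ω u z = inner ℝ w u := by
  obtain ⟨w, hw⟩ := exists_inner_eq_integral (memLp_divergence hz)
  exact ⟨-w, fun u => by rw [gradPairing, hw, inner_neg_left]⟩

theorem IsTestField.zero : IsTestField Ω 0 :=
  ⟨contDiff_const, .zero, by simp [tsupport]⟩

theorem IsTestField.const_smul {z : Plane → Plane} (hz : IsTestField Ω z) (c : ℝ) :
    IsTestField Ω (c • z) :=
  ⟨hz.contDiff.const_smul c, hz.compact.smul_left (f := fun _ => c),
    (closure_mono (Function.support_const_smul_subset c z)).trans hz.support⟩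

theorem divergence_const_smul {z : Plane → Plane} (hz : IsTestField Ω z) (c : ℝ) (x : Plane) :
    divergence (c • z) x = c * divergence z x := by
  simp only [divergence, Finset.mul_sum]
  refine Finset.sum_congr rfl fun i _ => ?_
  have hd : DifferentiableAt ℝ (fun y => z y i) x :=
    (contDiff_coord hz.contDiff i).differentiable one_ne_zero x
  have : (fun y => (c • z) y i) = fun y => c * z y i := by ext y; simp
  rw [partialDeriv, this, fderiv_const_mul hd]
  simp [partialDeriv]

theorem gradPairing_const_smul {z : Plane → Plane} (hz : IsTestField Ω z) (c : ℝ) (u : L2 Ω) :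
    gradPairing Ω u (c • z) = c * gradPairing Ω u z := by
  simp only [gradPairing, divergence_const_smul hz]
  rw [mul_neg, ← integral_const_mul]
  congr 2
  ext x
  ring

theorem norm_le_sum_abs (y : Plane) : ‖y‖ ≤ |y 0| + |y 1| := by
  rw [EuclideanSpace.norm_eq, Fin.sum_univ_two, Real.norm_eq_abs, Real.norm_eq_abs]
  refine Real.sqrt_le_iff.2 ⟨by positivity, ?_⟩
  nlinarith [mul_nonneg (abs_nonneg (y 0)) (abs_nonneg (y 1))]

/-- The Euclidean unit ball lies in the max-norm ball, which lies in twice the Euclidean one, so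
rescaling the test field changes only the constant. -/
theorem isBV_iff (u : L2 Ω) : IsBV Ω u ↔ ∃ C : ℝ, ∀ z : Plane → Plane, IsTestField Ω z →
    (∀ x i, |z x i| ≤ 1) → gradPairing Ω u z ≤ C := by
  constructor
  · rintro ⟨C, hC⟩
    refine ⟨2 * C, fun z hz h1 => ?_⟩
    have h2 := hC ((1 / 2 : ℝ) • z) (hz.const_smul _) fun x => by
      have h3 := norm_le_sum_abs (z x)
      have h4 := h1 x 0
      have h5 := h1 x 1
      rw [Pi.smul_apply, norm_smul]
      norm_num
      linarith
    rw [gradPairing_const_smul hz] at h2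
    linarith
  · rintro ⟨C, hC⟩
    exact ⟨C, fun z hz h1 => hC z hz fun x i => (PiLp.norm_apply_le (z x) i).trans (h1 x)⟩

/-- By `isBV_iff` the value ⊤ is prescribed exactly where the supremum is infinite anyway, so `Phi0`
is a plain supremum of linear functionals, as `isProximal_of_le_iff` requires. -/
theorem Phi0_le_iff {β : ℝ} (hβ : 0 < β) (u : L2 Ω) (c : ℝ) : Phi0 Ω β u ≤ c ↔
    ∀ z : Plane → Plane, IsTestField Ω z → (∀ x i, |z x i| ≤ 1) → β * gradPairing Ω u z ≤ c := by
  have key : (β : EReal) * anisoVariation Ω u ≤ c ↔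
      ∀ z : Plane → Plane, IsTestField Ω z → (∀ x i, |z x i| ≤ 1) → β * gradPairing Ω u z ≤ c := by
    have hβ' : (0 : EReal) < β := EReal.coe_pos.2 hβ
    rw [mul_comm, ← EReal.le_div_iff_mul_le hβ' (EReal.coe_ne_top β), ← EReal.coe_div,
      anisoVariation]
    simp only [iSup_le_iff, EReal.coe_le_coe_iff, le_div_iff₀ hβ, mul_comm β]
  by_cases h : IsBV Ω u
  · rw [Phi0, if_pos h, key]
  · rw [Phi0, if_neg h]
    refine iff_of_false (not_le.2 (EReal.coe_lt_top c)) fun h' => h ((isBV_iff u).2 ⟨c / β, ?_⟩)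
    intro z hz h1
    rw [le_div_iff₀ hβ, mul_comm]
    exact h' z hz h1

/-- Integrating by parts onto φ bounds every pairing by the L¹ norms of the partial derivatives of
φ. -/
theorem Phi0_ne_top {β : ℝ} (hβ : 0 < β) {u : L2 Ω} (hu : u ∈ testFunctionClasses Ω) :
    Phi0 Ω β u ≠ ⊤ := by
  obtain ⟨φ, hφ, hu⟩ := hu
  have h1 : ContDiff ℝ 1 φ := hφ.contDiff.of_le (by exact_mod_cast le_top)
  have hint : ∀ i : Fin 2, Integrable (partialDeriv i φ) (volume.restrict Ω) := fun i =>
    ((continuous_partialDeriv h1 i).integrable_of_hasCompactSupport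
      (hasCompactSupport_partialDeriv hφ.compact i)).restrict
  refine ((Phi0_le_iff hβ u (β * ∑ i : Fin 2, ∫ x in Ω, |partialDeriv i φ x|)).2
    fun z hz hz1 => ?_).trans_lt (EReal.coe_lt_top _) |>.ne
  refine mul_le_mul_of_nonneg_left ?_ hβ.le
  have hzi := fun i => contDiff_coord hz.contDiff i
  have e1 : gradPairing Ω u z = ∑ i : Fin 2, ∫ x in Ω, partialDeriv i φ x * z x i := by
    have e2 : ∫ x in Ω, u x * divergence z x =
        ∫ x in Ω, ∑ i : Fin 2, φ x * partialDeriv i (fun y => z y i) x := by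
      refine integral_congr_ae ?_
      filter_upwards [hu] with x hx
      rw [hx, divergence, Finset.mul_sum]
    rw [gradPairing, e2, integral_finsetSum, ← Finset.sum_neg_distrib]
    · refine Finset.sum_congr rfl fun i _ => ?_
      rw [setIntegral_mul_partialDeriv h1 hφ.compact hφ.support (hzi i), neg_neg]
    · intro i _
      exact ((h1.continuous.mul (continuous_partialDeriv (hzi i) i)).integrable_of_hasCompactSupport
        hφ.compact.mul_right).restrict
  rw [e1]
  refine Finset.sum_le_sum fun i _ => integral_mono ?_ (hint i).abs fun x => ?_
  · exact (((continuous_partialDeriv h1 i).mul (hzi i).continuous).integrable_of_hasCompactSupport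
      (hasCompactSupport_partialDeriv hφ.compact i).mul_right).restrict
  · refine (le_abs_self _).trans ?_
    rw [abs_mul]
    exact mul_le_of_le_one_right (abs_nonneg _) (hz1 x i)

theorem isProximal_Phi0 (hΩ : IsOpen Ω) {β : ℝ} (hβ : 0 < β) : IsProximal (Phi0 Ω β) := by
  refine isProximal_of_le_iff
    (E := {w | ∃ z, IsTestField Ω z ∧ (∀ x i, |z x i| ≤ 1) ∧
      ∀ u, β * gradPairing Ω u z = inner ℝ w u})
    ⟨0, .zero, by simp, fun u => ?_⟩ (fun u c => ?_)
    ((dense_testFunctionClasses hΩ).mono fun u hu => Phi0_ne_top hβ hu)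
  · have := gradPairing_const_smul (Ω := Ω) (z := 0) .zero 0 u
    rw [smul_zero, zero_mul] at this
    rw [this, mul_zero, inner_zero_left]
  · rw [Phi0_le_iff hβ]
    constructor
    · rintro h w ⟨z, hz, h1, hw⟩
      rw [← hw]
      exact h z hz h1
    · intro h z hz h1
      obtain ⟨w, hw⟩ := exists_inner_eq_gradPairing hz
      have hw' : ∀ u, β * gradPairing Ω u z = inner ℝ (β • w) u := fun u => by
        rw [hw, inner_smul_left]; rfl
      rw [hw']
      exact h _ ⟨z, hz, h1, hw'⟩

end TotalVariation

/-! ### The functional `Phi1` and weak gradients. -/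

section Dirichlet

/-- The space `L²(Ω; ℝ²)`. -/
abbrev VectorL2 (Ω : Set Plane) : Type := Lp Plane 2 (volume.restrict Ω)

/-- The integrand of `Φ₁`. -/
def density (β γ : ℝ) (y : Plane) : ℝ := γ / 2 * ‖y‖ ^ 2 + β * (|y 0| + |y 1|)

/-- The functional `Φ₁` in terms of the gradient. -/
def densityLIntegral (Ω : Set Plane) (β γ : ℝ) (g : VectorL2 Ω) : ENNReal :=
  ∫⁻ x in Ω, ENNReal.ofReal (density β γ (g x))

variable {Ω : Set Plane} {β γ : ℝ}

theorem continuous_density : Continuous (density β γ) := by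
  unfold density; fun_prop

theorem density_nonneg (hβ : 0 < β) (hγ : 0 < γ) (y : Plane) : 0 ≤ density β γ y := by
  unfold density; positivity

theorem density_zero : density β γ 0 = 0 := by simp [density]

/-- The quadratic term obeys an exact identity with remainder t(1 - t)‖p - q‖², and the rest is
convex. The remainder supplies the uniform convexity in the gradient. -/
theorem density_combo_le (hβ : 0 < β) (p q : Plane) {t : ℝ} (ht0 : 0 < t) (ht1 : t < 1) :
    density β γ ((1 - t) • p + t • q) + γ / 2 * (t * (1 - t) * ‖p - q‖ ^ 2) ≤
      (1 - t) * density β γ p + t * density β γ q := by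
  have h1 : ‖(1 - t) • p + t • q‖ ^ 2 =
      (1 - t) * ‖p‖ ^ 2 + t * ‖q‖ ^ 2 - t * (1 - t) * ‖p - q‖ ^ 2 := by
    rw [norm_add_sq_real, norm_sub_sq_real, norm_smul, norm_smul, inner_smul_left,
      inner_smul_right, Real.norm_of_nonneg ht0.le, Real.norm_of_nonneg (by linarith : 0 ≤ 1 - t)]
    simp only [conj_trivial]
    ring
  have h2 : ∀ i, |((1 - t) • p + t • q) i| ≤ (1 - t) * |p i| + t * |q i| := fun i => by
    rw [PiLp.add_apply, PiLp.smul_apply, PiLp.smul_apply, smul_eq_mul, smul_eq_mul]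
    refine (abs_add_le _ _).trans_eq ?_
    rw [abs_mul, abs_mul, abs_of_pos ht0, abs_of_pos (by linarith : 0 < 1 - t)]
  have h3 := mul_le_mul_of_nonneg_left (add_le_add (h2 0) (h2 1)) hβ.le
  rw [density, density, density, h1]
  linarith

theorem aestronglyMeasurable_density (g : VectorL2 Ω) :
    AEStronglyMeasurable (fun x => density β γ (g x)) (volume.restrict Ω) :=
  continuous_density.comp_aestronglyMeasurable (Lp.aestronglyMeasurable g)

theorem integrable_density_iff (hβ : 0 < β) (hγ : 0 < γ) (g : VectorL2 Ω) :
    Integrable (fun x => density β γ (g x)) (volume.restrict Ω) ↔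
      densityLIntegral Ω β γ g ≠ ⊤ :=
  (lintegral_ofReal_ne_top_iff_integrable (aestronglyMeasurable_density g)
    (Eventually.of_forall fun x => density_nonneg hβ hγ (g x))).symm

theorem toReal_densityLIntegral (hβ : 0 < β) (hγ : 0 < γ) (g : VectorL2 Ω) :
    (densityLIntegral Ω β γ g).toReal = ∫ x in Ω, density β γ (g x) :=
  (integral_eq_lintegral_of_nonneg_ae (Eventually.of_forall fun x => density_nonneg hβ hγ (g x))
    (aestronglyMeasurable_density g)).symm

theorem densityLIntegral_combo (hβ : 0 < β) (hγ : 0 < γ) {p q : VectorL2 Ω}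
    (hp : densityLIntegral Ω β γ p ≠ ⊤) (hq : densityLIntegral Ω β γ q ≠ ⊤) {t : ℝ} (ht0 : 0 < t)
    (ht1 : t < 1) : densityLIntegral Ω β γ ((1 - t) • p + t • q) ≠ ⊤ ∧
      (densityLIntegral Ω β γ ((1 - t) • p + t • q)).toReal + γ / 2 * (t * (1 - t) * ‖p - q‖ ^ 2) ≤
        (1 - t) * (densityLIntegral Ω β γ p).toReal + t * (densityLIntegral Ω β γ q).toReal := by
  have hp' := (integrable_density_iff hβ hγ p).2 hp
  have hq' := (integrable_density_iff hβ hγ q).2 hq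
  have hR := (hp'.const_mul (1 - t)).add (hq'.const_mul t)
  have hd : Integrable (fun x => ‖(p - q) x‖ ^ 2) (volume.restrict Ω) :=
    (Lp.memLp (p - q)).integrable_norm_pow two_ne_zero
  have hpt : ∀ᵐ x ∂volume.restrict Ω, density β γ (((1 - t) • p + t • q : VectorL2 Ω) x) +
      γ / 2 * (t * (1 - t) * ‖(p - q) x‖ ^ 2) ≤
        (1 - t) * density β γ (p x) + t * density β γ (q x) := by
    filter_upwards [Lp.coeFn_add ((1 - t) • p) (t • q), Lp.coeFn_smul (1 - t) p,
      Lp.coeFn_smul t q, Lp.coeFn_sub p q] with x h1 h2 h3 h4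
    rw [h1, h4, Pi.add_apply, h2, h3]
    exact density_combo_le hβ (p x) (q x) ht0 ht1
  have ht2 : 0 < 1 - t := by linarith
  have hr : Integrable (fun x => density β γ (((1 - t) • p + t • q : VectorL2 Ω) x))
      (volume.restrict Ω) := by
    refine hR.mono' (aestronglyMeasurable_density _) ?_
    filter_upwards [hpt] with x hx
    rw [Real.norm_of_nonneg (density_nonneg hβ hγ _)]
    refine le_trans ?_ hx
    exact le_add_of_nonneg_right (by positivity)
  refine ⟨(integrable_density_iff hβ hγ _).1 hr, ?_⟩
  have hn : ‖p - q‖ ^ 2 = ∫ x in Ω, ‖(p - q) x‖ ^ 2 := by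
    rw [← real_inner_self_eq_norm_sq, L2.inner_def]
    simp only [real_inner_self_eq_norm_sq]
  simp only [toReal_densityLIntegral hβ hγ]
  rw [hn, ← integral_const_mul, ← integral_const_mul, ← integral_const_mul, ← integral_const_mul,
    ← integral_add hr ((hd.const_mul _).const_mul _),
    ← integral_add (hp'.const_mul _) (hq'.const_mul _)]
  exact integral_mono_ae (hr.add ((hd.const_mul _).const_mul _)) hR hpt

/-- Pass to an almost everywhere convergent subsequence and apply Fatou's lemma. Continuity is not
to be expected when Ω has infinite measure, as the linear part of the density may then fail to be
integrable. -/
theorem lowerSemicontinuous_densityLIntegral :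
    LowerSemicontinuous (densityLIntegral Ω β γ) := by
  rw [lowerSemicontinuous_iff_isClosed_preimage]
  intro y
  refine IsSeqClosed.isClosed fun g g' hg hlim => ?_
  obtain ⟨ns, -, hns⟩ := (tendstoInMeasure_of_tendsto_Lp hlim).exists_seq_tendsto_ae
  have h1 : densityLIntegral Ω β γ g' =
      ∫⁻ x in Ω, liminf (fun n => ENNReal.ofReal (density β γ (g (ns n) x))) atTop := by
    refine lintegral_congr_ae ?_
    filter_upwards [hns] with x hx
    exact (((ENNReal.continuous_ofReal.comp continuous_density).tendsto _).comp hx).liminf_eq.symm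
  show densityLIntegral Ω β γ g' ≤ y
  rw [h1]
  refine (lintegral_liminf_le' fun n =>
    (aestronglyMeasurable_density (g (ns n))).aemeasurable.ennreal_ofReal).trans ?_
  exact (liminf_le_liminf (Eventually.of_forall fun n => hg (ns n))).trans_eq (liminf_const y)

/-- For each test function the weak gradient identity is the vanishing of a continuous linear
functional of the pair (u, g); hence the graph is a closed subspace. -/
theorem exists_inner_weakGradient {φ : Plane → ℝ} (hφ : IsTestFunction Ω φ) (i : Fin 2) :
    ∃ (w : L2 Ω) (w' : VectorL2 Ω), ∀ (u : L2 Ω) (g : VectorL2 Ω),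
      (∫ x in Ω, u x * partialDeriv i φ x = -∫ x in Ω, g x i * φ x) ↔
        inner ℝ w u + inner ℝ w' g = 0 := by
  have h1 : ContDiff ℝ 1 φ := hφ.contDiff.of_le (by exact_mod_cast le_top)
  obtain ⟨w, hw⟩ := exists_inner_eq_integral (Ω := Ω)
    (memLp_of_hasCompactSupport (continuous_partialDeriv h1 i)
      (hasCompactSupport_partialDeriv hφ.compact i))
  have hm : MemLp (fun x => φ x • (EuclideanSpace.single i 1 : Plane)) 2 (volume.restrict Ω) :=
    memLp_of_hasCompactSupport (h1.continuous.smul continuous_const) hφ.compact.smul_right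
  refine ⟨w, hm.toLp _, fun u g => ?_⟩
  have h2 : ∫ x in Ω, g x i * φ x = inner ℝ (hm.toLp _) g := by
    rw [L2.inner_def]
    refine integral_congr_ae ?_
    filter_upwards [hm.coeFn_toLp] with x hx
    rw [hx, inner_smul_left, EuclideanSpace.inner_single_left]
    simp [mul_comm]
  rw [hw, h2, eq_neg_iff_add_eq_zero]

theorem HasWeakGradient.combo {u v : L2 Ω} {g k : VectorL2 Ω} (h : HasWeakGradient Ω u g)
    (h' : HasWeakGradient Ω v k) (a b : ℝ) :
    HasWeakGradient Ω (a • u + b • v) (a • g + b • k) := by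
  intro φ h1 h2 h3 i
  obtain ⟨w, w', hw⟩ := exists_inner_weakGradient ⟨h1, h2, h3⟩ i
  have e1 := (hw u g).1 (h φ h1 h2 h3 i)
  have e2 := (hw v k).1 (h' φ h1 h2 h3 i)
  rw [hw, inner_add_right, inner_add_right, inner_smul_right, inner_smul_right, inner_smul_right,
    inner_smul_right]
  linear_combination a * e1 + b * e2

theorem HasWeakGradient.zero : HasWeakGradient Ω 0 0 := by
  intro φ h1 h2 h3 i
  obtain ⟨w, w', hw⟩ := exists_inner_weakGradient ⟨h1, h2, h3⟩ i
  rw [hw, inner_zero_right, inner_zero_right, add_zero]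

theorem isClosed_hasWeakGradient :
    IsClosed {p : L2 Ω × VectorL2 Ω | HasWeakGradient Ω p.1 p.2} := by
  have e1 : {p : L2 Ω × VectorL2 Ω | HasWeakGradient Ω p.1 p.2} =
      ⋂ (φ : Plane → ℝ) (_ : IsTestFunction Ω φ) (i : Fin 2),
        {p | ∫ x in Ω, p.1 x * partialDeriv i φ x = -∫ x in Ω, p.2 x i * φ x} := by
    ext p
    simp only [Set.mem_ofPred_eq, mem_iInter]
    exact ⟨fun h φ hφ i => h φ hφ.1 hφ.2 hφ.3 i, fun h φ h1 h2 h3 i => h φ ⟨h1, h2, h3⟩ i⟩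
  rw [e1]
  refine isClosed_iInter fun φ => isClosed_iInter fun hφ => isClosed_iInter fun i => ?_
  obtain ⟨w, w', hw⟩ := exists_inner_weakGradient hφ i
  simp only [hw]
  exact isClosed_eq (by fun_prop) continuous_const

/-- Uniqueness of the weak gradient removes the choice made in `weakGradient`. -/
theorem Phi1_eq (hΩ : IsOpen Ω) {u : L2 Ω} {g : VectorL2 Ω} (h : HasWeakGradient Ω u g) :
    Phi1 Ω β γ u = densityLIntegral Ω β γ g := by
  have hu : IsH1 Ω u := ⟨g, h⟩
  have e1 : weakGradient hu = g := HasWeakGradient.unique hΩ hu.choose_spec h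
  rw [Phi1, dif_pos hu, e1]
  rfl

theorem toReal_Phi1 (hΩ : IsOpen Ω) {u : L2 Ω} {g : VectorL2 Ω} (h : HasWeakGradient Ω u g) :
    (Phi1 Ω β γ u).toReal = (densityLIntegral Ω β γ g).toReal := by
  rw [Phi1_eq hΩ h, EReal.toReal_coe_ennreal]

theorem Phi1_ne_top_iff (hΩ : IsOpen Ω) (u : L2 Ω) : Phi1 Ω β γ u ≠ ⊤ ↔
    ∃ g, HasWeakGradient Ω u g ∧ densityLIntegral Ω β γ g ≠ ⊤ := by
  constructor
  · intro h
    have hu : IsH1 Ω u := by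
      by_contra hu
      exact h (by rw [Phi1, dif_neg hu])
    obtain ⟨g, hg⟩ := hu
    refine ⟨g, hg, fun h' => h ?_⟩
    rw [Phi1_eq hΩ hg, h', EReal.coe_ennreal_top]
  · rintro ⟨g, hg, h⟩
    rw [Phi1_eq hΩ hg]
    simpa using h

theorem Phi1_ne_top (hΩ : IsOpen Ω) (hβ : 0 < β) (hγ : 0 < γ) {u : L2 Ω}
    (hu : u ∈ testFunctionClasses Ω) : Phi1 Ω β γ u ≠ ⊤ := by
  obtain ⟨φ, hφ, hu⟩ := hu
  have h1 : ContDiff ℝ 1 φ := hφ.contDiff.of_le (by exact_mod_cast le_top)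
  set z : Plane → Plane := fun x => WithLp.toLp 2 fun i => partialDeriv i φ x with hz
  have hzc : Continuous z :=
    (PiLp.continuous_toLp 2 _).comp (continuous_pi fun i => continuous_partialDeriv h1 i)
  have hzs : HasCompactSupport z := by
    refine hφ.compact.mono' fun x hx => ?_
    by_contra hx'
    refine hx ?_
    ext i
    simpa [hz] using partialDeriv_eq_zero hx' i
  have hm : MemLp z 2 (volume.restrict Ω) := memLp_of_hasCompactSupport hzc hzs
  refine (Phi1_ne_top_iff hΩ u).2 ⟨hm.toLp z, fun ψ hψ hc hs i => ?_, ?_⟩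
  · have h2 := setIntegral_mul_partialDeriv h1 hφ.compact hφ.support
      (hψ.of_le (by exact_mod_cast le_top)) i
    have e1 : ∫ x in Ω, u x * partialDeriv i ψ x = ∫ x in Ω, φ x * partialDeriv i ψ x :=
      integral_congr_ae (by filter_upwards [hu] with x hx; rw [hx])
    have e2 : ∫ x in Ω, hm.toLp z x i * ψ x = ∫ x in Ω, partialDeriv i φ x * ψ x :=
      integral_congr_ae (by filter_upwards [hm.coeFn_toLp] with x hx; rw [hx])
    rw [e1, e2, h2]
  · rw [← integrable_density_iff hβ hγ]
    have h3 : Integrable (fun x => density β γ (z x)) (volume.restrict Ω) :=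
      ((continuous_density.comp hzc).integrable_of_hasCompactSupport
        (hzs.comp_left density_zero)).restrict
    exact h3.congr (by filter_upwards [hm.coeFn_toLp] with x hx; rw [hx])

/-- Minimizing over pairs (u, g) in the graph of the weak gradient makes both components of a
minimizing sequence converge strongly. -/
theorem exists_minimizer_Phi1 (hΩ : IsOpen Ω) (hβ : 0 < β) (hγ : 0 < γ) {l : ℝ} (hl : 0 < l)
    (f : L2 Ω) : ∃ u, Phi1 Ω β γ u ≠ ⊤ ∧ ∀ w, Phi1 Ω β γ w ≠ ⊤ →
      (Phi1 Ω β γ u).toReal + ‖u - f‖ ^ 2 / (2 * l) ≤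
        (Phi1 Ω β γ w).toReal + ‖w - f‖ ^ 2 / (2 * l) := by
  set J := densityLIntegral Ω β γ with hJ
  have hJ0 : J 0 ≠ ⊤ := by
    rw [hJ, ← integrable_density_iff hβ hγ]
    refine (integrable_zero _ _ _).congr ?_
    filter_upwards [Lp.coeFn_zero Plane 2 (volume.restrict Ω)] with x hx
    rw [hx]
    exact density_zero.symm
  suffices h : ∃ p ∈ {p : L2 Ω × VectorL2 Ω | HasWeakGradient Ω p.1 p.2 ∧ J p.2 ≠ ⊤},
      ∀ q ∈ {p : L2 Ω × VectorL2 Ω | HasWeakGradient Ω p.1 p.2 ∧ J p.2 ≠ ⊤},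
        (J p.2).toReal + ‖p.1 - f‖ ^ 2 / (2 * l) ≤ (J q.2).toReal + ‖q.1 - f‖ ^ 2 / (2 * l) by
    obtain ⟨⟨u, g⟩, ⟨hug, hg⟩, hmin⟩ := h
    refine ⟨u, (Phi1_ne_top_iff hΩ u).2 ⟨g, hug, hg⟩, fun w hw => ?_⟩
    obtain ⟨k, hwk, hk⟩ := (Phi1_ne_top_iff hΩ w).1 hw
    rw [toReal_Phi1 hΩ hug, toReal_Phi1 hΩ hwk]
    exact hmin (w, k) ⟨hwk, hk⟩
  refine exists_minimizer (F := fun p : L2 Ω × VectorL2 Ω => (J p.2).toReal +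
    ‖p.1 - f‖ ^ 2 / (2 * l)) ⟨0, .zero, hJ0⟩ (fun p _ => by positivity)
    -- 1/(8l) is the gain in u from the parallelogram law and γ/8 the gain in g at t = 1/2; the
    -- minimum appears because the product carries the max distance.
    (c := min (1 / (8 * l)) (γ / 8)) (by positivity) ?_ ?_
  · rintro ⟨u, g⟩ ⟨hu, hg⟩ ⟨v, k⟩ ⟨hv, hk⟩
    have h1 := densityLIntegral_combo hβ hγ hg hk (t := 1 / 2) (by norm_num) (by norm_num)
    rw [show (1 - 1 / 2 : ℝ) = 1 / 2 by norm_num, ← hJ] at h1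
    refine ⟨((1 / 2 : ℝ) • u + (1 / 2 : ℝ) • v, (1 / 2 : ℝ) • g + (1 / 2 : ℝ) • k),
      ⟨hu.combo hv _ _, h1.1⟩, ?_⟩
    have h2 := h1.2
    simp only
    rw [norm_midpoint_sub_sq, Prod.dist_eq, dist_eq_norm, dist_eq_norm]
    have e1 : ((‖u - f‖ ^ 2 + ‖v - f‖ ^ 2) / 2 - ‖u - v‖ ^ 2 / 4) / (2 * l) =
      (‖u - f‖ ^ 2 / (2 * l) + ‖v - f‖ ^ 2 / (2 * l)) / 2 - 1 / (8 * l) * ‖u - v‖ ^ 2 := by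
      field_simp; ring
    have h3 : min (1 / (8 * l)) (γ / 8) * max ‖u - v‖ ‖g - k‖ ^ 2 ≤
        1 / (8 * l) * ‖u - v‖ ^ 2 + γ / 8 * ‖g - k‖ ^ 2 := by
      have h4 : 0 ≤ 1 / (8 * l) * ‖u - v‖ ^ 2 := by positivity
      have h5 : 0 ≤ γ / 8 * ‖g - k‖ ^ 2 := by positivity
      rcases max_choice ‖u - v‖ ‖g - k‖ with h | h
      · rw [h]
        exact (mul_le_mul_of_nonneg_right (min_le_left _ _) (sq_nonneg _)).trans (by linarith)
      · rw [h]
        exact (mul_le_mul_of_nonneg_right (min_le_right _ _) (sq_nonneg _)).trans (by linarith)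
    rw [e1]
    linarith
  · intro a
    -- Written in `ENNReal`, the condition encodes finiteness of J and lets its lower semicontinuity
    -- apply. The separate bound on the penalty rules out a < 0, where `ENNReal.ofReal a` would be
    -- 0.
    have e1 : {p : L2 Ω × VectorL2 Ω | p ∈ {p : L2 Ω × VectorL2 Ω | HasWeakGradient Ω p.1 p.2 ∧
        J p.2 ≠ ⊤} ∧ (J p.2).toReal + ‖p.1 - f‖ ^ 2 / (2 * l) ≤ a} =
      {p | HasWeakGradient Ω p.1 p.2} ∩ ({p | ‖p.1 - f‖ ^ 2 / (2 * l) ≤ a} ∩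
        (fun p => J p.2 + ENNReal.ofReal (‖p.1 - f‖ ^ 2 / (2 * l))) ⁻¹' Iic (ENNReal.ofReal a)) := by
      ext p
      simp only [Set.mem_ofPred_eq, mem_inter_iff, mem_preimage, mem_Iic, and_assoc]
      refine and_congr_right fun _ => ?_
      have hs : 0 ≤ ‖p.1 - f‖ ^ 2 / (2 * l) := by positivity
      constructor
      · rintro ⟨h1, h2⟩
        refine ⟨le_trans (le_add_of_nonneg_left ENNReal.toReal_nonneg) h2, ?_⟩
        rw [← ENNReal.ofReal_toReal h1, ← ENNReal.ofReal_add ENNReal.toReal_nonneg hs]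
        exact ENNReal.ofReal_le_ofReal h2
      · rintro ⟨h1, h2⟩
        have h3 : J p.2 ≠ ⊤ := ne_top_of_le_ne_top ENNReal.ofReal_ne_top (le_self_add.trans h2)
        refine ⟨h3, ?_⟩
        rwa [← ENNReal.ofReal_toReal h3, ← ENNReal.ofReal_add ENNReal.toReal_nonneg hs,
          ENNReal.ofReal_le_ofReal_iff (hs.trans h1)] at h2
    rw [e1]
    refine isClosed_hasWeakGradient.inter ((isClosed_le (by fun_prop) continuous_const).inter ?_)
    refine LowerSemicontinuous.isClosed_preimage (LowerSemicontinuous.add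
      (lowerSemicontinuous_densityLIntegral.comp continuous_snd)
      (Continuous.lowerSemicontinuous ?_)) _
    exact ENNReal.continuous_ofReal.comp (by fun_prop)

theorem isProximal_Phi1 (hΩ : IsOpen Ω) (hβ : 0 < β) (hγ : 0 < γ) :
    IsProximal (Phi1 Ω β γ) where
  nonneg u := by
    rw [Phi1]
    split_ifs
    · exact EReal.coe_ennreal_nonneg _
    · exact le_top
  zero := by
    rw [Phi1_eq hΩ .zero, densityLIntegral]
    have : ∫⁻ x in Ω, ENNReal.ofReal (density β γ ((0 : VectorL2 Ω) x)) = ∫⁻ x in Ω, 0 := by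
      refine lintegral_congr_ae ?_
      filter_upwards [Lp.coeFn_zero Plane 2 (volume.restrict Ω)] with x hx
      rw [hx, Pi.zero_apply, density_zero, ENNReal.ofReal_zero]
    rw [this, lintegral_zero, EReal.coe_ennreal_zero]
  convex {u v} hu hv {t} ht0 ht1 := by
    obtain ⟨g, hug, hg⟩ := (Phi1_ne_top_iff hΩ u).1 hu
    obtain ⟨k, hvk, hk⟩ := (Phi1_ne_top_iff hΩ v).1 hv
    obtain ⟨h1, h2⟩ := densityLIntegral_combo hβ hγ hg hk ht0 ht1
    rw [Phi1_eq hΩ (hug.combo hvk _ _), toReal_Phi1 hΩ hug, toReal_Phi1 hΩ hvk,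
      ← EReal.coe_toReal (x := (densityLIntegral Ω β γ _ : EReal)) (by simpa using h1) (by simp),
      EReal.coe_le_coe_iff, EReal.toReal_coe_ennreal]
    have ht2 : 0 < 1 - t := by linarith
    exact (le_add_of_nonneg_right (by positivity)).trans h2
  minimizer := exists_minimizer_Phi1 hΩ hβ hγ
  dense := (dense_testFunctionClasses hΩ).mono fun _ hu => Phi1_ne_top hΩ hβ hγ hu

end Dirichlet

theorem isGradientOperator_A {Ω : Set Plane} (hΩ : IsOpen Ω) {β γ : ℝ} (hβ : 0 < β) (hγ : 0 < γ)
    (i : Fin 2) : ∃ e, IsGradientOperator (A Ω β γ i) e := by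
  rw [A]
  split_ifs
  · exact ⟨_, (isProximal_Phi0 hΩ hβ).isGradientOperator⟩
  · exact ⟨_, (isProximal_Phi1 hΩ hβ hγ).isGradientOperator⟩

end AnisoDiffusion

end

theorem mainTheorem2 (Ω : Set AnisoDiffusion.Plane) (hΩ : IsOpen Ω)
    (β γ : ℝ) (hβ : 0 < β) (hγ : 0 < γ) (i : Fin 2) (u₀ : AnisoDiffusion.L2 Ω) :
    ∃ u : ℝ → AnisoDiffusion.L2 Ω,
      AnisoDiffusion.IsPointwiseSolution (AnisoDiffusion.A Ω β γ i) u₀ u ∧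
      AnisoDiffusion.IsStrongSolution (AnisoDiffusion.A Ω β γ i) u₀ u ∧
      (∀ v : ℝ → AnisoDiffusion.L2 Ω,
        (AnisoDiffusion.IsPointwiseSolution (AnisoDiffusion.A Ω β γ i) u₀ v ∨
          AnisoDiffusion.IsStrongSolution (AnisoDiffusion.A Ω β γ i) u₀ v) →
        ∀ t, 0 ≤ t → v t = u t) ∧
      ∀ t, 0 < t →
        u t ∈ AnisoDiffusion.domain (AnisoDiffusion.A Ω β γ i) ∧
        AnisoDiffusion.RightInclusion
          (AnisoDiffusion.minimalSection (AnisoDiffusion.A Ω β γ i)) u t := by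
  obtain ⟨e, he⟩ := AnisoDiffusion.isGradientOperator_A hΩ hβ hγ i
  exact he.exists_solution u₀
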